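/- Let $d\ge 1$ and let $\Omega_1,\Omega_2\subset\mathbb R^d$ be nonempty bounded connected open sets, with Lipschitz boundary if $d\ge 2$ (so for $d=1$ they are bounded open intervals). Here Lipschitz boundary means that near each boundary point the set is, in suitable orthonormal coordinates, the region on one side of the graph of a Lipschitz function. Let $C(\overline{\Omega}_i)$ denote the complex-valued continuous functions on $\overline{\Omega}_i$ with the supremum norm, and $C_c^\infty(\Omega_1)$ the smooth complex-valued functions on $\mathbb R^d$ whose support is a compact subset of $\Omega_1$, regarded as a subspace of $C(\overline\Omega_1)$ by restriction. For $\beta\in C(\partial\Omega_2)$ (complex-valued), the domain $D(\Delta^\beta_{\Omega_2})$ of the Robin Laplacian on $C(\overline\Omega_2)$ is the set of all $u\in H^1(\Omega_2)\cap C(\overline\Omega_2)$ whose distributional Laplacian $\Delta u$ belongs to $C(\overline\Omega_2)$ and whose normal derivative exists in $L^2(\partial\Omega_2)$ and equals $-\beta u$, that is, $$\int_{\Omega_2}\bigl(\nabla u\cdot\overline{\nabla v}+\Delta u\,\overline v\bigr)\,dx=-\int_{\partial\Omega_2}\beta u\,\overline v\,d\sigma\qquad\text{for all } v\in H^1(\Omega_2),$$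 where $v$ on $\partial\Omega_2$ is the trace of $v$ and $\sigma$ is surface measure (counting measure if $d=1$). The operator acts by $\Delta^\beta_{\Omega_2}u=\Delta u$. For $\beta=0$ it is the Neumann Laplacian. Let $U:C(\overline\Omega_1)\to C(\overline\Omega_2)$ be a bounded linear operator such that (a) $f\cdot g=0$ implies $(Uf)\cdot(Ug)=0$ for all $f,g\in C(\overline\Omega_1)$; (b) there is $\beta\in C(\partial\Omega_2)$ with $U(C_c^\infty(\Omega_1))\subset D(\Delta^\beta_{\Omega_2})$, and $U(\Delta f)=\Delta(Uf)$ for all $f\in C_c^\infty(\Omega_1)$; (c) if $\omega\subset\Omega_2$ is open and $(Uf)|_\omega=0$ for all $f\in C_c^\infty(\Omega_1)$, then $\omega=\emptyset$. Assume moreover that at least one of the following holds: (d) $|\Omega_1|=|\Omega_2|$ (Lebesgue measure); or (e) $U$ has dense range in $C(\overline\Omega_2)$. Then there exist an isometry $\tau:\mathbb R^d\to\mathbb R^d$ with $\tau(\Omega_2)=\Omega_1$ and a constant $c\in\mathbb C\setminus\{0\}$ such that $$Uf=c\,f\circ\tau\quad\text{on }\overline\Omega_2\qquad\text{for all } f\in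 C(\overline\Omega_1).$$ In particular, $\Omega_1$ and $\Omega_2$ are congruent. -/

import Mathlib

open MeasureTheory Topology Filter Set TopologicalSpace
open scoped NNReal ContDiff Distributions InnerProductSpace MeasureTheory

noncomputable section

namespace RobinCongruence

variable {d : ℕ}

/-- The `i`-th partial derivative `∂f/∂x_i` of a function on `ℝ^d`. -/
def partialDeriv (i : Fin d) (f : EuclideanSpace ℝ (Fin d) → ℂ)
    (x : EuclideanSpace ℝ (Fin d)) : ℂ :=
  fderiv ℝ f x (EuclideanSpace.single i 1)

/-- `Ω` is a Lipschitz domain: near each boundary point `z` there is a direction `e` (a unit vector)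
such that `Ω` is the region strictly below the graph of a Lipschitz function `γ` of the component of
`x` orthogonal to `e`. -/
def IsLipschitzDomain (Ω : Opens (EuclideanSpace ℝ (Fin d))) : Prop :=
  ∀ z ∈ frontier (Ω : Set (EuclideanSpace ℝ (Fin d))),
    ∃ (e : EuclideanSpace ℝ (Fin d)) (γ : EuclideanSpace ℝ (Fin d) → ℝ) (K : ℝ≥0) (r : ℝ),
      ‖e‖ = 1 ∧ LipschitzWith K γ ∧ 0 < r ∧
      ∀ x ∈ Metric.ball z r, x ∈ Ω ↔ inner ℝ e x < γ (x - (inner ℝ e x) • e)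

/-- The surface measure `σ` on the boundary of `Ω`: the `(d-1)`-dimensional Hausdorff measure,
normalised to agree with Lebesgue measure on hyperplanes, restricted to `∂Ω`. -/
def surfaceMeasure (Ω : Opens (EuclideanSpace ℝ (Fin d))) :
    Measure (EuclideanSpace ℝ (Fin d)) :=
  (μHE[d - 1]).restrict (frontier (Ω : Set (EuclideanSpace ℝ (Fin d))))

/-- Membership in `L^2(Ω)`. -/
def MemL2 (Ω : Opens (EuclideanSpace ℝ (Fin d))) (u : EuclideanSpace ℝ (Fin d) → ℂ) : Prop :=
  MemLp u 2 (volume.restrict (Ω : Set (EuclideanSpace ℝ (Fin d))))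

/-- `G` is the distributional gradient of `u` on `Ω`, where `𝓓(Ω, ℂ)` is `C_c^∞(Ω)`. -/
def IsWeakGradient (Ω : Opens (EuclideanSpace ℝ (Fin d))) (u : EuclideanSpace ℝ (Fin d) → ℂ)
    (G : Fin d → EuclideanSpace ℝ (Fin d) → ℂ) : Prop :=
  ∀ (i : Fin d) (φ : 𝓓(Ω, ℂ)),
    ∫ x in (Ω : Set (EuclideanSpace ℝ (Fin d))), u x * partialDeriv i φ x =
      -∫ x in (Ω : Set (EuclideanSpace ℝ (Fin d))), G i x * φ x

/-- `w = Δu` on `Ω` in the sense of distributions. -/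
def IsWeakLaplacian (Ω : Opens (EuclideanSpace ℝ (Fin d)))
    (u w : EuclideanSpace ℝ (Fin d) → ℂ) : Prop :=
  ∀ φ : 𝓓(Ω, ℂ),
    ∫ x in (Ω : Set (EuclideanSpace ℝ (Fin d))),
        u x * Laplacian.laplacian (φ : EuclideanSpace ℝ (Fin d) → ℂ) x =
      ∫ x in (Ω : Set (EuclideanSpace ℝ (Fin d))), w x * φ x

/-- `u ∈ H^1(Ω)`, with distributional gradient `G`. -/
structure IsH1 (Ω : Opens (EuclideanSpace ℝ (Fin d))) (u : EuclideanSpace ℝ (Fin d) → ℂ)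
    (G : Fin d → EuclideanSpace ℝ (Fin d) → ℂ) : Prop where
  memL2 : MemL2 Ω u
  memL2_grad : ∀ i, MemL2 Ω (G i)
  isWeakGradient : IsWeakGradient Ω u G

/-- `t ∈ L^2(∂Ω)` is the boundary trace of the function `v ∈ H^1(Ω)` with gradient `G`: some
functions `ψ n ∈ C^∞(ℝ^d)` converge to `v` in `H^1(Ω)` and their restrictions to `∂Ω` converge
to `t` in `L^2(∂Ω)`. -/
def IsTrace (Ω : Opens (EuclideanSpace ℝ (Fin d))) (v : EuclideanSpace ℝ (Fin d) → ℂ)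
    (G : Fin d → EuclideanSpace ℝ (Fin d) → ℂ) (t : EuclideanSpace ℝ (Fin d) → ℂ) : Prop :=
  MemLp t 2 (surfaceMeasure Ω) ∧
  ∃ ψ : ℕ → EuclideanSpace ℝ (Fin d) → ℂ,
    (∀ n, ContDiff ℝ ∞ (ψ n)) ∧
    Tendsto (fun n => eLpNorm (fun x => ψ n x - v x) 2
      (volume.restrict (Ω : Set (EuclideanSpace ℝ (Fin d))))) atTop (𝓝 0) ∧
    (∀ i, Tendsto (fun n => eLpNorm (fun x => partialDeriv i (ψ n) x - G i x) 2
      (volume.restrict (Ω : Set (EuclideanSpace ℝ (Fin d))))) atTop (𝓝 0)) ∧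
    Tendsto (fun n => eLpNorm (fun x => ψ n x - t x) 2 (surfaceMeasure Ω)) atTop (𝓝 0)

/-- `u ∈ H^1(Ω)` with `Δu ∈ L^2(Ω)` has the distributional outer normal derivative
`∂u/∂ν = h ∈ L^2(∂Ω)`: Green's formula
`∫_Ω (∇u · conj ∇v + Δu conj v) dx = ∫_{∂Ω} h conj v dσ` holds for all `v ∈ H^1(Ω)`,
where `v` on `∂Ω` is understood as the trace. -/
def HasNormalDeriv (Ω : Opens (EuclideanSpace ℝ (Fin d)))
    (u h : EuclideanSpace ℝ (Fin d) → ℂ) : Prop :=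
  ∃ (G : Fin d → EuclideanSpace ℝ (Fin d) → ℂ) (w : EuclideanSpace ℝ (Fin d) → ℂ),
    IsH1 Ω u G ∧ MemL2 Ω w ∧ IsWeakLaplacian Ω u w ∧ MemLp h 2 (surfaceMeasure Ω) ∧
    ∀ (v : EuclideanSpace ℝ (Fin d) → ℂ) (Gv : Fin d → EuclideanSpace ℝ (Fin d) → ℂ)
      (t : EuclideanSpace ℝ (Fin d) → ℂ), IsH1 Ω v Gv → IsTrace Ω v Gv t →
      ∫ x in (Ω : Set (EuclideanSpace ℝ (Fin d))),
          ((∑ i, G i x * (starRingEnd ℂ) (Gv i x)) + w x * (starRingEnd ℂ) (v x)) =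
        ∫ x, h x * (starRingEnd ℂ) (t x) ∂(surfaceMeasure Ω)

/-- Extension by zero to `ℝ^d` of a continuous function on a subset (used for `C(closure Ω)` and
`C(∂Ω)`, so that its elements can be integrated over `Ω` and `∂Ω`). -/
def zeroExt {s : Set (EuclideanSpace ℝ (Fin d))} (u : C(s, ℂ)) :
    EuclideanSpace ℝ (Fin d) → ℂ :=
  Function.extend Subtype.val u 0

/-- The domain `D(Δ^β)` of the Robin Laplacian on `C(closure Ω)`: the functions
`u ∈ H^1(Ω) ∩ C(closure Ω)` with `Δu ∈ C(closure Ω)` whose normal derivative exists in `L^2(∂Ω)`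
and equals `-β u`. The operator acts on it as the distributional Laplacian. -/
def robinDomain (Ω : Opens (EuclideanSpace ℝ (Fin d)))
    (β : C(frontier (Ω : Set (EuclideanSpace ℝ (Fin d))), ℂ)) :
    Set C(closure (Ω : Set (EuclideanSpace ℝ (Fin d))), ℂ) :=
  {u | (∃ w : C(closure (Ω : Set (EuclideanSpace ℝ (Fin d))), ℂ),
          IsWeakLaplacian Ω (zeroExt u) (zeroExt w)) ∧
       HasNormalDeriv Ω (zeroExt u) (fun x => -(zeroExt β x * zeroExt u x))}

/-- A test function on `Ω`, as an element of `C(closure Ω)`. -/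
def testRestrict {Ω : Opens (EuclideanSpace ℝ (Fin d))} (f : 𝓓(Ω, ℂ)) :
    C(closure (Ω : Set (EuclideanSpace ℝ (Fin d))), ℂ) :=
  ⟨fun x => f x, by fun_prop⟩

theorem continuous_laplacian {f : EuclideanSpace ℝ (Fin d) → ℂ} (hf : ContDiff ℝ ∞ f) :
    Continuous (Laplacian.laplacian f) := by
  rw [InnerProductSpace.laplacian_eq_iteratedFDeriv_stdOrthonormalBasis]
  have h : Continuous (iteratedFDeriv ℝ 2 f) :=
    hf.continuous_iteratedFDeriv (WithTop.coe_le_coe.2 (le_top : (2 : ℕ∞) ≤ ⊤))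
  fun_prop

/-- The (classical) Laplacian of a test function on `Ω`, as an element of `C(closure Ω)`. -/
def testLaplacian {Ω : Opens (EuclideanSpace ℝ (Fin d))} (f : 𝓓(Ω, ℂ)) :
    C(closure (Ω : Set (EuclideanSpace ℝ (Fin d))), ℂ) :=
  ⟨fun x => Laplacian.laplacian (f : EuclideanSpace ℝ (Fin d) → ℂ) x,
    (continuous_laplacian f.contDiff).comp continuous_subtype_val⟩

end RobinCongruence

end

/-! Evaluating `U f` at a point gives a disjointness preserving functional on `C(closure Ω₁)`, and
such a functional is a multiple of a point evaluation (`exists_eq_mul_eval`). Hence `U f = h · (f ∘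
τ)` with `h = U 1` (`weight`), and `τ` (`symbol`) is continuous where `h ≠ 0`.

Let `W` (`activeSet`) be the open set of points of `Ω₂` where `h ≠ 0` and `τ` takes values in `Ω₁`.
Near a point of `W`, cut-offs allow the intertwining relation to be applied to `1`, `⟨a, x⟩` and
`⟨a, x⟩²`. Thus `h` and `h⟨a, τ⟩` are weakly harmonic, so `h` and `τ` are smooth by Weyl's lemma,
and `Δ(h⟨a, τ⟩²) = 2|a|²h`. The product rule then gives `|∇⟨a, τ⟩| = |a|`. So `Dτ` is orthogonal,
which forces `D²τ = 0`. Harmonicity of `h⟨a, τ⟩` then leaves `∇h · ∇⟨a, τ⟩ = 0` for all `a`, hence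
`∇h = 0` (`fderiv_eq_zero_of_intertwining`). On each component `D` of `W`, `U` is a nonzero constant
times composition with a rigid motion.

The boundary condition shows that this motion maps `D` onto `Ω₁`
(`exists_rigidMotion_image_component`). Otherwise, by connectedness of `Ω₁`, some point of `closure
D` outside `D` is sent into `Ω₁`. Maximality of `D` puts that point on `∂Ω₂`. A Lipschitz domain is
locally connected at its boundary, so `D` fills `Ω₂` near the point, and every harmonic function,
constant or linear, satisfies the same Robin condition there. Comparing `1` with `⟨e, x⟩` eliminates
`β` and says that the distributional derivative `∂_e` of the indicator of `Ω₂` vanishes near the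
point, which is false for a region below a graph (`IsLipschitzDomain.false_of_integral_eq`).

Finally `D` is dense in `Ω₂`. If the volumes agree, `Ω₂ \ D` is null. If `U` has dense range, `τ` is
injective on `closure Ω₂`, so `D` is all of `W`, which is dense by (c). The formula extends to the
closures by continuity, and `τ(Ω₂) = Ω₁` because a Lipschitz domain is the interior of its closure.
-/

noncomputable section

namespace RobinCongruence

/-! ### The Laplacian in coordinates, and rigidity of maps with isometric differential. -/

section Laplacian

variable {E : Type*} [NormedAddCommGroup E] [InnerProductSpace ℝ E] [FiniteDimensional ℝ E]

theorem laplacian_eq_sum_fderiv {ι : Type*} [Fintype ι] (b : OrthonormalBasis ι ℝ E)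
    {F : Type*} [NormedAddCommGroup F] [NormedSpace ℝ F] (f : E → F) (x : E) :
    Laplacian.laplacian f x = ∑ i, fderiv ℝ (fderiv ℝ f) x (b i) (b i) := by
  rw [InnerProductSpace.laplacian_eq_iteratedFDeriv_orthonormalBasis f b]
  simp [iteratedFDeriv_two_apply]

theorem laplacian_mul {ι : Type*} [Fintype ι] (b : OrthonormalBasis ι ℝ E) {f g : E → ℂ} {x : E}
    (hf : ContDiffAt ℝ 2 f x) (hg : ContDiffAt ℝ 2 g x) :
    Laplacian.laplacian (fun y => f y * g y) x =
      f x * Laplacian.laplacian g x + 2 * ∑ i, fderiv ℝ f x (b i) * fderiv ℝ g x (b i) +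
        g x * Laplacian.laplacian f x := by
  have hf' : ∀ᶠ y in 𝓝 x, DifferentiableAt ℝ f y :=
    (hf.eventually (by simp)).mono fun y hy => hy.differentiableAt (by simp)
  have hg' : ∀ᶠ y in 𝓝 x, DifferentiableAt ℝ g y :=
    (hg.eventually (by simp)).mono fun y hy => hy.differentiableAt (by simp)
  have h1 : fderiv ℝ (fun y => f y * g y) =ᶠ[𝓝 x]
      fun y => f y • fderiv ℝ g y + g y • fderiv ℝ f y := by
    filter_upwards [hf', hg'] with y h1 h2
    exact fderiv_fun_mul h1 h2
  have hdf : DifferentiableAt ℝ (fderiv ℝ f) x :=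
    (hf.fderiv_right (m := 1) (by norm_num)).differentiableAt (by simp)
  have hdg : DifferentiableAt ℝ (fderiv ℝ g) x :=
    (hg.fderiv_right (m := 1) (by norm_num)).differentiableAt (by simp)
  have h2 := (hf'.self_of_nhds.hasFDerivAt.fun_smul hdg.hasFDerivAt).fun_add
    (hg'.self_of_nhds.hasFDerivAt.fun_smul hdf.hasFDerivAt)
  rw [laplacian_eq_sum_fderiv b, laplacian_eq_sum_fderiv b, laplacian_eq_sum_fderiv b, h1.fderiv_eq,
    h2.fderiv, Finset.mul_sum, Finset.mul_sum, Finset.mul_sum, ← Finset.sum_add_distrib,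
    ← Finset.sum_add_distrib]
  refine Finset.sum_congr rfl fun i _ => ?_
  simp
  ring

/-- A map whose differentials are linear isometries has vanishing second derivative. -/
theorem fderiv_fderiv_eq_zero_of_isometric {s : Set E} (hs : IsOpen s) {τ : E → E}
    (hτ : ContDiffOn ℝ 2 τ s) (h : ∀ x ∈ s, ∀ u, ‖fderiv ℝ τ x u‖ = ‖u‖) {x : E} (hx : x ∈ s) :
    fderiv ℝ (fderiv ℝ τ) x = 0 := by
  have hτx : ContDiffAt ℝ 2 τ x := hτ.contDiffAt (hs.mem_nhds hx)
  have hd : DifferentiableAt ℝ (fderiv ℝ τ) x :=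
    (hτx.fderiv_right (m := 1) (by norm_num)).differentiableAt (by simp)
  set F := fderiv ℝ τ x with hF
  set A := fderiv ℝ (fderiv ℝ τ) x with hA
  have hsymm : ∀ u v, A u v = A v u := by
    have := hτx.isSymmSndFDerivAt (by simp)
    exact fun u v => this u v
  have hinner : ∀ y ∈ s, ∀ u v, ⟪fderiv ℝ τ y u, fderiv ℝ τ y v⟫_ℝ = ⟪u, v⟫_ℝ := by
    intro y hy u v
    exact (LinearMap.norm_map_iff_inner_map_map (𝕜 := ℝ) (fderiv ℝ τ y)).1 (h y hy) u v
  have hskew : ∀ m u v : E, ⟪A m u, F v⟫_ℝ + ⟪F u, A m v⟫_ℝ = 0 := by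
    intro m u v
    have hu : HasFDerivAt (fun y => fderiv ℝ τ y u) (A.flip u) x := by
      simpa using hd.hasFDerivAt.clm_apply (hasFDerivAt_const u x)
    have hv : HasFDerivAt (fun y => fderiv ℝ τ y v) (A.flip v) x := by
      simpa using hd.hasFDerivAt.clm_apply (hasFDerivAt_const v x)
    have h1 := hu.inner ℝ hv
    have h2 : (fun y => ⟪fderiv ℝ τ y u, fderiv ℝ τ y v⟫_ℝ) =ᶠ[𝓝 x] fun _ => ⟪u, v⟫_ℝ := by
      filter_upwards [hs.mem_nhds hx] with y hy using hinner y hy u v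
    have h3 := (hasFDerivAt_const (𝕜 := ℝ) ⟪u, v⟫_ℝ x).congr_of_eventuallyEq h2
    have h4 := congrArg (fun L => L m) (h1.unique h3)
    simpa [add_comm, fderivInnerCLM_apply] using h4
  -- The form `⟪A m u, F v⟫` is symmetric in its first two arguments, by symmetry of second
  -- derivatives, and antisymmetric in its last two, by `hskew`. Alternating the two exchanges shows
  -- that it equals its own negative.
  have hzero : ∀ m u v : E, ⟪A m u, F v⟫_ℝ = 0 := by
    have swap : ∀ m u v : E, ⟪A m u, F v⟫_ℝ = -⟪A m v, F u⟫_ℝ := by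
      intro m u v
      have := hskew m u v
      rw [real_inner_comm (A m v) (F u)] at this
      linarith
    intro m u v
    have e1 := swap m u v
    have e2 := swap v m u
    have e3 := swap u v m
    rw [hsymm m v] at e1
    rw [hsymm v u] at e2
    rw [hsymm u m] at e3
    linarith
  have hsurj : Function.Surjective F := by
    have hinj : Function.Injective (F : E →ₗ[ℝ] E) := by
      refine (injective_iff_map_eq_zero (F : E →ₗ[ℝ] E)).2 fun u hu => ?_
      have := h x hx u
      rw [← norm_eq_zero, ← this]
      simpa using hu
    exact (LinearMap.injective_iff_surjective.1 hinj)
  ext m u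
  obtain ⟨v, hv⟩ := hsurj (A m u)
  have := hzero m u v
  rw [hv] at this
  simpa using this

end Laplacian

/-! ### Differentiation of integrals with respect to a parameter. -/

section ParametricIntegral

variable {E : Type*} [NormedAddCommGroup E] [MeasurableSpace E] [BorelSpace E]
  {μ : Measure E}

/-- Differentiation under the integral sign for a kernel supported in a fixed compact set. -/
theorem hasDerivAt_integral_mul_of_compact {u : E → ℂ} {k k' : ℝ → E → ℂ} {K : Set E}
    (hK : IsCompact K) (hu : IntegrableOn u K μ) {t₀ : ℝ} {s : Set ℝ} (hs : s ∈ 𝓝 t₀)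
    (hk : ∀ t ∈ s, Continuous (k t)) (hk' : ContinuousOn (Function.uncurry k') (s ×ˢ univ))
    (hderiv : ∀ t ∈ s, ∀ x, HasDerivAt (fun t => k t x) (k' t x) t)
    (hsupp : ∀ t ∈ s, ∀ x ∉ K, k t x = 0) (hsupp' : ∀ t ∈ s, ∀ x ∉ K, k' t x = 0) :
    HasDerivAt (fun t => ∫ x, u x * k t x ∂μ) (∫ x, u x * k' t₀ x ∂μ) t₀ := by
  obtain ⟨r, hr, hrs⟩ := Metric.nhds_basis_closedBall.mem_iff.1 hs
  have hKm : MeasurableSet K := hK.isClosed.measurableSet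
  have hset : ∀ f : E → ℂ, (∀ x ∉ K, f x = 0) → ∫ x, u x * f x ∂μ = ∫ x in K, u x * f x ∂μ := by
    intro f hf
    refine (setIntegral_eq_integral_of_forall_compl_eq_zero fun x hx => ?_).symm
    simp [hf x hx]
  obtain ⟨C, hC⟩ := ((isCompact_closedBall t₀ r).prod hK).exists_bound_of_continuousOn
    (hk'.mono (prod_mono hrs (subset_univ _)))
  have key := hasDerivAt_integral_of_dominated_loc_of_deriv_le (μ := μ.restrict K)
    (F := fun t x => u x * k t x) (F' := fun t x => u x * k' t x) (x₀ := t₀)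
    (s := Metric.ball t₀ r) (bound := fun x => ‖u x‖ * C) (Metric.ball_mem_nhds t₀ hr)
    ?_ ?_ ?_ ?_ ?_ ?_
  · rw [hset _ (hsupp' t₀ (mem_of_mem_nhds hs))]
    refine key.2.congr_of_eventuallyEq ?_
    filter_upwards [hs] with t ht using hset _ (hsupp t ht)
  · filter_upwards [hs] with t ht
    exact hu.aestronglyMeasurable.mul
      ((hk t ht).continuousOn.aestronglyMeasurable_of_isCompact hK hKm)
  · exact hu.mul_continuousOn (hk t₀ (mem_of_mem_nhds hs)).continuousOn hK
  · refine AEStronglyMeasurable.mul hu.aestronglyMeasurable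
      (ContinuousOn.aestronglyMeasurable_of_isCompact ?_ hK hKm)
    exact hk'.comp (by fun_prop : Continuous fun x : E => (t₀, x)).continuousOn
      fun x _ => ⟨mem_of_mem_nhds hs, mem_univ _⟩
  · refine (ae_restrict_mem hKm).mono fun x hx t ht => ?_
    rw [norm_mul]
    exact mul_le_mul_of_nonneg_left (hC (t, x) ⟨Metric.ball_subset_closedBall ht, hx⟩)
      (norm_nonneg _)
  · exact hu.norm.mul_const C
  · refine Eventually.of_forall fun x t ht => ?_
    exact (hderiv t (hrs (Metric.ball_subset_closedBall ht)) x).const_mul (u x)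

end ParametricIntegral

/-! ### Integration by parts, and weak versus classical Laplacians. -/

section IntegrationByParts

theorem fderiv_fderiv_apply {E : Type*} [NormedAddCommGroup E] [NormedSpace ℝ E]
    {f : E → ℂ} {x : E} (h : DifferentiableAt ℝ (fderiv ℝ f) x) (v w : E) :
    fderiv ℝ (fun y => fderiv ℝ f y v) x w = fderiv ℝ (fderiv ℝ f) x w v := by
  have := h.hasFDerivAt.clm_apply (hasFDerivAt_const v x)
  rw [this.fderiv]
  simp

theorem integrable_mul_of_continuousOn {E : Type*} [NormedAddCommGroup E] [MeasurableSpace E]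
    [BorelSpace E] {μ : Measure E} [IsFiniteMeasureOnCompacts μ]
    {f g : E → ℂ} {s : Set E} (hf : ContinuousOn f s) (hg : Continuous g)
    (hc : HasCompactSupport g) (hsub : tsupport g ⊆ s) : Integrable (fun x => f x * g x) μ := by
  rw [← integrableOn_iff_integrable_of_support_subset (s := tsupport g)]
  · exact ((hf.mono hsub).mul hg.continuousOn).integrableOn_compact hc
  · exact fun x hx => subset_tsupport g (right_ne_zero_of_mul hx)

variable {E : Type*} [NormedAddCommGroup E] [InnerProductSpace ℝ E] [FiniteDimensional ℝ E]
  [MeasurableSpace E] [BorelSpace E]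

theorem integral_mul_fderiv_of_contDiffOn {f g : E → ℂ} {s : Set E} (hs : IsOpen s)
    (hf : ContDiffOn ℝ 1 f s) (hg : ContDiff ℝ 1 g) (hc : HasCompactSupport g)
    (hsub : tsupport g ⊆ s) (v : E) :
    ∫ x, f x * fderiv ℝ g x v = -∫ x, fderiv ℝ f x v * g x := by
  have hgv : Continuous fun x => fderiv ℝ g x v :=
    (hg.continuous_fderiv (by simp)).clm_apply continuous_const
  refine integral_mul_fderiv_eq_neg_fderiv_mul_of_integrable ?_ ?_ ?_ ?_ ?_
  · exact integrable_mul_of_continuousOn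
      ((hf.continuousOn_fderiv_of_isOpen hs (by simp)).clm_apply continuousOn_const)
      hg.continuous hc hsub
  · refine integrable_mul_of_continuousOn hf.continuousOn hgv (hc.fderiv_apply ℝ v) ?_
    exact (tsupport_fderiv_apply_subset ℝ v).trans hsub
  · exact integrable_mul_of_continuousOn hf.continuousOn hg.continuous hc hsub
  · exact fun x hx => (hf.contDiffAt (hs.mem_nhds (hsub hx))).differentiableAt (by simp)
  · exact fun x _ => hg.differentiable (by simp) x

/-- Two integrations by parts in each direction of an orthonormal basis. Smoothness of `f` is needed
only on `s`, since `g` and its derivatives are supported there. -/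
theorem integral_mul_laplacian {f g : E → ℂ} {s : Set E} (hs : IsOpen s)
    (hf : ContDiffOn ℝ 2 f s) (hg : ContDiff ℝ 2 g) (hc : HasCompactSupport g)
    (hsub : tsupport g ⊆ s) :
    ∫ x, f x * Laplacian.laplacian g x = ∫ x, Laplacian.laplacian f x * g x := by
  set b := stdOrthonormalBasis ℝ E
  have hg1 : ∀ v, ContDiff ℝ 1 fun x => fderiv ℝ g x v := fun v =>
    (hg.fderiv_right (m := 1) (by norm_num)).clm_apply contDiff_const
  have hf1 : ∀ v, ContDiffOn ℝ 1 (fun x => fderiv ℝ f x v) s := fun v =>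
    (hf.fderiv_of_isOpen hs (m := 1) (by norm_num)).clm_apply contDiffOn_const
  have hg2 : ∀ v x, fderiv ℝ (fun y => fderiv ℝ g y v) x v = fderiv ℝ (fderiv ℝ g) x v v :=
    fun v x => fderiv_fderiv_apply ((hg.fderiv_right (m := 1) (by norm_num)).differentiable
      (by simp) x) v v
  have hf2 : ∀ v, ∀ x ∈ s, fderiv ℝ (fun y => fderiv ℝ f y v) x v = fderiv ℝ (fderiv ℝ f) x v v :=
    fun v x hx => fderiv_fderiv_apply (((hf.fderiv_of_isOpen hs (m := 1) (by norm_num)).contDiffAt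
      (hs.mem_nhds hx)).differentiableAt (by simp)) v v
  have hsub1 : ∀ v, tsupport (fun x => fderiv ℝ g x v) ⊆ s := fun v =>
    (tsupport_fderiv_apply_subset ℝ v).trans hsub
  have key : ∀ v, ∫ x, f x * fderiv ℝ (fun y => fderiv ℝ g y v) x v =
      ∫ x, fderiv ℝ (fun y => fderiv ℝ f y v) x v * g x := fun v => by
    rw [integral_mul_fderiv_of_contDiffOn hs (hf.of_le (by norm_num)) (hg1 v)
      (hc.fderiv_apply ℝ v) (hsub1 v), integral_mul_fderiv_of_contDiffOn hs (hf1 v)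
      (hg.of_le (by norm_num)) hc hsub, neg_neg]
  have e1 : ∀ x, f x * Laplacian.laplacian g x =
      ∑ i, f x * fderiv ℝ (fun y => fderiv ℝ g y (b i)) x (b i) := fun x => by
    rw [laplacian_eq_sum_fderiv b, Finset.mul_sum]
    exact Finset.sum_congr rfl fun i _ => by rw [hg2]
  have e2 : ∀ x, Laplacian.laplacian f x * g x =
      ∑ i, fderiv ℝ (fun y => fderiv ℝ f y (b i)) x (b i) * g x := fun x => by
    by_cases hx : x ∈ s
    · rw [laplacian_eq_sum_fderiv b, Finset.sum_mul]
      exact Finset.sum_congr rfl fun i _ => by rw [hf2 _ x hx]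
    · have : g x = 0 := image_eq_zero_of_notMem_tsupport fun h => hx (hsub h)
      simp [this]
  simp_rw [e1, e2]
  rw [integral_finsetSum, integral_finsetSum]
  · exact Finset.sum_congr rfl fun i _ => key (b i)
  · intro i _
    exact integrable_mul_of_continuousOn
      (((hf1 (b i)).continuousOn_fderiv_of_isOpen hs (by simp)).clm_apply continuousOn_const)
      hg.continuous hc hsub
  · intro i _
    refine integrable_mul_of_continuousOn hf.continuousOn
      (((hg1 (b i)).continuous_fderiv (by simp)).clm_apply continuous_const)
      ((hc.fderiv_apply ℝ (b i)).fderiv_apply ℝ (b i)) ?_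
    exact (tsupport_fderiv_apply_subset ℝ _).trans (hsub1 _)

/-- Two continuous functions on an open set which agree as distributions are equal. -/
theorem eqOn_of_integral_mul_eq {f g : E → ℂ} {s : Set E} (hs : IsOpen s)
    (hf : ContinuousOn f s) (hg : ContinuousOn g s)
    (h : ∀ φ : E → ℂ, ContDiff ℝ ∞ φ → HasCompactSupport φ → tsupport φ ⊆ s →
      ∫ x, f x * φ x = ∫ x, g x * φ x) : EqOn f g s := by
  have hloc : LocallyIntegrableOn (fun x => f x - g x) s :=
    (hf.sub hg).locallyIntegrableOn hs.measurableSet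
  have h1 := hs.ae_eq_zero_of_integral_contDiff_smul_eq_zero (μ := volume) hloc ?_
  · have h2 : (fun x => f x - g x) =ᵐ[volume.restrict s] fun _ => 0 := by
      rw [EventuallyEq, ae_restrict_iff' hs.measurableSet]
      exact h1
    have h3 := Measure.eqOn_open_of_ae_eq h2 hs (hf.sub hg) continuousOn_const
    exact fun x hx => sub_eq_zero.1 (h3 hx)
  · intro φ hφ hc hsub
    have hsupp : tsupport (fun x => (φ x : ℂ)) ⊆ s := by
      refine subset_trans (closure_mono fun x hx => ?_) hsub
      simpa using hx
    have hφc : ContDiff ℝ ∞ fun x => (φ x : ℂ) := Complex.ofRealCLM.contDiff.comp hφ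
    have hcc : HasCompactSupport fun x => (φ x : ℂ) := hc.comp_left Complex.ofReal_zero
    have := h _ hφc hcc hsupp
    rw [← sub_eq_zero, ← integral_sub
      (integrable_mul_of_continuousOn hf hφc.continuous hcc hsupp)
      (integrable_mul_of_continuousOn hg hφc.continuous hcc hsupp)] at this
    rw [← this]
    refine integral_congr_ae (Eventually.of_forall fun x => ?_)
    simp only [Complex.real_smul]
    ring

/-- A twice continuously differentiable function with a continuous distributional Laplacian has
that function as its classical Laplacian. -/
theorem laplacian_eqOn_of_weak {u w : E → ℂ} {s : Set E} (hs : IsOpen s)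
    (hu : ContDiffOn ℝ 2 u s) (hw : ContinuousOn w s)
    (h : ∀ φ : E → ℂ, ContDiff ℝ ∞ φ → HasCompactSupport φ → tsupport φ ⊆ s →
      ∫ x, u x * Laplacian.laplacian φ x = ∫ x, w x * φ x) :
    EqOn (Laplacian.laplacian u) w s := by
  refine eqOn_of_integral_mul_eq hs ?_ hw fun φ h1 h2 h3 => ?_
  · have : ContinuousOn (fun x => ∑ i, fderiv ℝ (fderiv ℝ u) x (stdOrthonormalBasis ℝ E i)
        (stdOrthonormalBasis ℝ E i)) s := by
      refine continuousOn_finsetSum _ fun i _ => ?_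
      exact ((((hu.fderiv_of_isOpen hs (m := 1) (by norm_num)).continuousOn_fderiv_of_isOpen hs
        (by simp)).clm_apply continuousOn_const).clm_apply continuousOn_const)
    exact this.congr fun x _ => laplacian_eq_sum_fderiv _ _ _
  · rw [← h φ h1 h2 h3]
    exact (integral_mul_laplacian hs hu (h1.of_le
      (WithTop.coe_le_coe.2 (le_top : (2 : ℕ∞) ≤ ⊤))) h2 h3).symm

end IntegrationByParts

/-! ### Weyl's lemma, by averaging against rescaled radial kernels. -/

section Weyl

set_option linter.unusedSectionVars false

/-- The derivative of `expNegInvGlue`. -/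
def glueDeriv (t : ℝ) : ℝ := (t⁻¹) ^ 2 * expNegInvGlue t

theorem hasDerivAt_expNegInvGlue (t : ℝ) : HasDerivAt expNegInvGlue (glueDeriv t) t := by
  simpa [glueDeriv] using expNegInvGlue.hasDerivAt_polynomial_eval_inv_mul 1 t

theorem contDiff_glueDeriv : ContDiff ℝ ∞ glueDeriv := by
  have h := expNegInvGlue.contDiff_polynomial_eval_inv_mul (n := ⊤) (Polynomial.X ^ 2)
  have e : glueDeriv = fun x => Polynomial.eval x⁻¹ (Polynomial.X ^ 2) * expNegInvGlue x := by
    funext t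
    simp [glueDeriv]
  rwa [e]

theorem glueDeriv_of_nonpos {t : ℝ} (ht : t ≤ 0) : glueDeriv t = 0 := by
  simp [glueDeriv, expNegInvGlue.zero_of_nonpos ht]

theorem glueDeriv_nonneg (t : ℝ) : 0 ≤ glueDeriv t :=
  mul_nonneg (sq_nonneg _) (expNegInvGlue.nonneg t)

theorem glueDeriv_one_pos : 0 < glueDeriv 1 := by
  simpa [glueDeriv] using expNegInvGlue.pos_of_pos one_pos

variable {E : Type*} [NormedAddCommGroup E] [InnerProductSpace ℝ E]

/-- A smooth radial function supported in the closed unit ball. -/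
def radialPotential (x : E) : ℝ := expNegInvGlue (1 - ‖x‖ ^ 2)

/-- The radial kernel `φ` with `∇ψ(x) = -φ(x) x`, where `ψ` is `radialPotential`. -/
def radialKernel (x : E) : ℝ := 2 * glueDeriv (1 - ‖x‖ ^ 2)

theorem contDiff_radialPotential : ContDiff ℝ ∞ (radialPotential : E → ℝ) :=
  (expNegInvGlue.contDiff (n := ⊤)).comp (contDiff_const.sub (contDiff_norm_sq ℝ))

theorem contDiff_radialKernel : ContDiff ℝ ∞ (radialKernel : E → ℝ) :=
  contDiff_const.mul (contDiff_glueDeriv.comp (contDiff_const.sub (contDiff_norm_sq ℝ)))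

theorem radialKernel_nonneg (x : E) : 0 ≤ radialKernel x :=
  mul_nonneg zero_le_two (glueDeriv_nonneg _)

theorem radialKernel_neg (x : E) : radialKernel (-x) = radialKernel x := by
  simp [radialKernel]

theorem radialKernel_of_one_le {x : E} (hx : 1 ≤ ‖x‖) : radialKernel x = 0 := by
  rw [radialKernel, glueDeriv_of_nonpos (by nlinarith), mul_zero]

theorem radialPotential_of_one_le {x : E} (hx : 1 ≤ ‖x‖) : radialPotential x = 0 :=
  expNegInvGlue.zero_of_nonpos (by nlinarith)

theorem fderiv_radialPotential (x v : E) :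
    fderiv ℝ radialPotential x v = -(radialKernel x * ⟪x, v⟫_ℝ) := by
  have h1 : HasFDerivAt (fun x : E => 1 - ‖x‖ ^ 2) (-(2 • innerSL ℝ x)) x := by
    simpa using ((hasStrictFDerivAt_norm_sq x).hasFDerivAt).const_sub 1
  have h2 := (hasDerivAt_expNegInvGlue (1 - ‖x‖ ^ 2)).comp_hasFDerivAt x h1
  have h3 : fderiv ℝ radialPotential x = glueDeriv (1 - ‖x‖ ^ 2) • -(2 • innerSL ℝ x) := h2.fderiv
  rw [h3]
  simp [radialKernel]
  ring

theorem hasCompactSupport_radialKernel [FiniteDimensional ℝ E] :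
    HasCompactSupport (radialKernel : E → ℝ) := by
  refine HasCompactSupport.intro (isCompact_closedBall 0 1) fun x hx => radialKernel_of_one_le ?_
  simp at hx
  exact hx.le

variable [FiniteDimensional ℝ E]

/-- With `n = dim E` and `k` the radial kernel, the bracket is what differentiating `c ^ n * k (c •
x)` in the scale `c` produces, up to rescaling. So the scale derivative of the averaging kernel is a
multiple of the Laplacian of a compactly supported function, and a weakly harmonic `u` annihilates
it. -/
theorem laplacian_radialPotential (x : E) :
    Laplacian.laplacian (radialPotential : E → ℝ) x =
      -(Module.finrank ℝ E * radialKernel x + fderiv ℝ radialKernel x x) := by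
  set b := stdOrthonormalBasis ℝ E
  have hk : HasFDerivAt radialKernel (fderiv ℝ radialKernel x) x :=
    (contDiff_radialKernel.differentiable (by simp) x).hasFDerivAt
  have hd : DifferentiableAt ℝ (fderiv ℝ (radialPotential : E → ℝ)) x :=
    ((contDiff_radialPotential (E := E)).fderiv_right (m := 1)
      (WithTop.coe_le_coe.2 le_top)).differentiable (by simp) x
  have h1 : ∀ v w : E, fderiv ℝ (fderiv ℝ radialPotential) x w v =
      -(radialKernel x * ⟪w, v⟫_ℝ + ⟪x, v⟫_ℝ * fderiv ℝ radialKernel x w) := by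
    intro v w
    have e1 := hd.hasFDerivAt.clm_apply (hasFDerivAt_const v x)
    have e2 : HasFDerivAt (fun y : E => ⟪y, v⟫_ℝ) (innerSL ℝ v) x := by
      have := (innerSL ℝ v).hasFDerivAt (x := x)
      refine this.congr_of_eventuallyEq (Eventually.of_forall fun y => ?_)
      simp [real_inner_comm]
    have e3 := (hk.mul e2).neg
    have e4 : (fun y => fderiv ℝ radialPotential y v) = -(radialKernel * fun y : E => ⟪y, v⟫_ℝ) := by
      funext y
      exact fderiv_radialPotential y v
    rw [e4] at e1
    have := congrArg (fun L => L w) (e1.unique e3)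
    simpa [real_inner_comm] using this
  rw [laplacian_eq_sum_fderiv b]
  simp_rw [h1]
  rw [Finset.sum_neg_distrib, Finset.sum_add_distrib]
  congr 2
  · simp [Finset.card_univ, mul_comm]
  · generalize fderiv ℝ radialKernel x = L
    conv_rhs => rw [← b.sum_repr' x]
    simp [map_sum, real_inner_comm]

theorem fderiv_comp_smul_sub {F : Type*} [NormedAddCommGroup F] [NormedSpace ℝ F] (f : E → F)
    (c : ℝ) (y : E) :
    fderiv ℝ (fun x => f (c • (x - y))) = fun x => c • fderiv ℝ f (c • (x - y)) := by
  funext x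
  rw [fderiv_comp_sub (f := fun z => f (c • z)), fderiv_comp_smul]

theorem laplacian_comp_smul_sub {F : Type*} [NormedAddCommGroup F] [NormedSpace ℝ F] (f : E → F)
    (c : ℝ) (y x : E) :
    Laplacian.laplacian (fun x => f (c • (x - y))) x =
      c ^ 2 • Laplacian.laplacian f (c • (x - y)) := by
  have h := fderiv_const_smul_field (𝕜 := ℝ) c (f := fun x => fderiv ℝ f (c • (x - y)))
  have h' : fderiv ℝ (fun x => c • fderiv ℝ f (c • (x - y))) x =
      c • c • fderiv ℝ (fderiv ℝ f) (c • (x - y)) := by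
    rw [fderiv_comp_smul_sub (fderiv ℝ f) c y] at h
    exact congrFun h x
  rw [laplacian_eq_sum_fderiv (stdOrthonormalBasis ℝ E),
    laplacian_eq_sum_fderiv (stdOrthonormalBasis ℝ E), fderiv_comp_smul_sub f c y, h',
    Finset.smul_sum]
  simp [pow_two, smul_smul]

variable [MeasurableSpace E] [BorelSpace E]

theorem integral_radialKernel_pos : 0 < ∫ x : E, radialKernel x := by
  refine (contDiff_radialKernel.continuous).integral_pos_of_hasCompactSupport_nonneg_nonzero
    hasCompactSupport_radialKernel radialKernel_nonneg (x := 0) ?_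
  simpa [radialKernel] using glueDeriv_one_pos.ne'

theorem laplacian_ofReal {f : E → ℝ} (hf : ContDiff ℝ 2 f) (x : E) :
    Laplacian.laplacian (fun x => (f x : ℂ)) x = (Laplacian.laplacian f x : ℝ) :=
  (hf.contDiffAt (x := x)).laplacian_CLM_comp_left (l := Complex.ofRealCLM)

/-- The rescaled averages of a weakly harmonic function do not depend on the scale. -/
theorem hasDerivAt_radialAverage [Nontrivial E] {u : E → ℂ} {s : Set E} (hu : ContinuousOn u s)
    (h : ∀ φ : E → ℂ, ContDiff ℝ ∞ φ → HasCompactSupport φ → tsupport φ ⊆ s →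
      ∫ x, u x * Laplacian.laplacian φ x = 0)
    {y : E} {r : ℝ} (hr : 0 < r) (hys : Metric.closedBall y r ⊆ s) {c : ℝ} (hc : r⁻¹ < c) :
    HasDerivAt (fun c : ℝ => ∫ x, u x *
      ((c ^ Module.finrank ℝ E * radialKernel (c • (x - y)) : ℝ) : ℂ)) 0 c := by
  -- Writing the dimension as `n + 1` makes the scale derivative of the kernel exactly `-(c ^ n * L
  -- (c • (x - y)))`, without truncated subtraction in the exponent.
  obtain ⟨n, hn⟩ : ∃ n, Module.finrank ℝ E = n + 1 :=
    Nat.exists_eq_succ_of_ne_zero Module.finrank_pos.ne'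
  have hr' : 0 < r⁻¹ := inv_pos.2 hr
  have far : ∀ c ∈ Ioi r⁻¹, ∀ x ∉ Metric.closedBall y r, 1 < ‖c • (x - y)‖ := by
    intro c hc x hx
    rw [Metric.mem_closedBall, not_le, dist_eq_norm] at hx
    have hc' : r⁻¹ < c := hc
    rw [norm_smul, Real.norm_of_nonneg (hr'.trans hc').le]
    calc 1 = r⁻¹ * r := (inv_mul_cancel₀ hr.ne').symm
      _ < c * ‖x - y‖ := by gcongr
  set L : E → ℝ := Laplacian.laplacian (radialPotential : E → ℝ) with hL
  have hLfun : L = fun x : E =>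
      -(Module.finrank ℝ E * radialKernel x + fderiv ℝ radialKernel x x) :=
    funext laplacian_radialPotential
  have hLcont : Continuous L := by
    rw [hLfun]
    have h1 := (contDiff_radialKernel (E := E)).continuous
    have h2 := (contDiff_radialKernel (E := E)).continuous_fderiv (by simp)
    fun_prop
  have hLzero : ∀ z : E, 1 < ‖z‖ → L z = 0 := by
    intro z hz
    have : (radialPotential : E → ℝ) =ᶠ[𝓝 z] fun _ => 0 := by
      filter_upwards [(isOpen_lt continuous_const continuous_norm).mem_nhds hz] with w hw
      exact radialPotential_of_one_le hw.le
    rw [hL, (InnerProductSpace.laplacian_congr_nhds this).eq_of_nhds]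
    simp
  have key := hasDerivAt_integral_mul_of_compact (μ := volume) (u := u)
    (k := fun c x => ((c ^ Module.finrank ℝ E * radialKernel (c • (x - y)) : ℝ) : ℂ))
    (k' := fun c x => ((-(c ^ n * L (c • (x - y))) : ℝ) : ℂ)) (K := Metric.closedBall y r)
    (isCompact_closedBall y r)
    ((hu.mono hys).integrableOn_compact (isCompact_closedBall y r)) (Ioi_mem_nhds hc)
    ?_ ?_ ?_ ?_ ?_
  · have hzero : ∫ x, u x * ((-(c ^ n * L (c • (x - y))) : ℝ) : ℂ) = 0 := by
      have hc0 : 0 < c := hr'.trans hc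
      have hP : ContDiff ℝ ∞ fun x : E => radialPotential (c • (x - y)) :=
        contDiff_radialPotential.comp (contDiff_const.smul (contDiff_id.sub contDiff_const))
      have hsupp : ∀ x ∉ Metric.closedBall y r,
          ((radialPotential (c • (x - y)) : ℝ) : ℂ) = 0 := fun x hx => by
        rw [radialPotential_of_one_le (far c hc x hx).le, Complex.ofReal_zero]
      have h0 := h (fun x => ((radialPotential (c • (x - y)) : ℝ) : ℂ))
        (Complex.ofRealCLM.contDiff.comp hP)
        (HasCompactSupport.intro (isCompact_closedBall y r) hsupp)
        (subset_trans (closure_minimal (fun x hx => by_contra fun h' =>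
          (Function.mem_support.1 hx) (hsupp x h')) Metric.isClosed_closedBall) hys)
      -- Rescaling the potential multiplies its Laplacian by `c ^ 2`, hence the quotient `c ^ n / c
      -- ^ 2`.
      have e : ∀ x, u x * ((-(c ^ n * L (c • (x - y))) : ℝ) : ℂ) =
          -((c : ℂ) ^ n / (c : ℂ) ^ 2) * (u x * Laplacian.laplacian
            (fun x => ((radialPotential (c • (x - y)) : ℝ) : ℂ)) x) := by
        intro x
        rw [laplacian_ofReal (hP.of_le (WithTop.coe_le_coe.2 le_top)), laplacian_comp_smul_sub]
        have : (c : ℂ) ≠ 0 := Complex.ofReal_ne_zero.2 hc0.ne'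
        push_cast [smul_eq_mul]
        field_simp
        rfl
      simp_rw [e]
      rw [integral_const_mul, h0, mul_zero]
    rwa [hzero] at key
  · intro c _
    have h1 := (contDiff_radialKernel (E := E)).continuous
    fun_prop
  · refine Continuous.continuousOn ?_
    simp only [Function.uncurry_def]
    fun_prop
  · intro c hc x
    have hc0 : c ≠ 0 := (hr'.trans hc).ne'
    have h1 : HasDerivAt (fun c : ℝ => c • (x - y)) (x - y) c := by
      simpa using (hasDerivAt_id c).smul_const (x - y)
    have h2 := (contDiff_radialKernel.differentiable (by simp)
      (c • (x - y))).hasFDerivAt.comp_hasDerivAt c h1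
    have h3 := ((hasDerivAt_pow (Module.finrank ℝ E) c).mul h2).ofReal_comp
    convert h3 using 1
    congr 1
    rw [hLfun, hn]
    simp only [map_smul, smul_eq_mul, Function.comp]
    push_cast
    simp
    ring
  · intro c hc x hx
    rw [radialKernel_of_one_le (far c hc x hx).le, mul_zero, Complex.ofReal_zero]
  · intro c hc x hx
    simp [hLzero _ (far c hc x hx)]

/-- **Weyl's lemma**: continuous weakly harmonic functions are smooth. -/
theorem contDiffOn_of_weakly_harmonic [Nontrivial E] {u : E → ℂ} {s : Set E} (hs : IsOpen s)
    (hu : ContinuousOn u s)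
    (h : ∀ φ : E → ℂ, ContDiff ℝ ∞ φ → HasCompactSupport φ → tsupport φ ⊆ s →
      ∫ x, u x * Laplacian.laplacian φ x = 0) : ContDiffOn ℝ ∞ u s := by
  intro x₀ hx₀
  obtain ⟨R, hR, hRs⟩ := Metric.nhds_basis_closedBall.mem_iff.1 (hs.mem_nhds hx₀)
  -- Halving the radius keeps `closedBall y r` inside `B` for every `y` within `r` of the centre.
  -- Cutting `u` off to `g` outside `B` then makes all averages integrals over the whole space
  -- without changing those at such `y`.
  obtain ⟨r, hr, rfl⟩ : ∃ r : ℝ, 0 < r ∧ R = r + r := ⟨R / 2, by positivity, by ring⟩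
  set B := Metric.closedBall x₀ (r + r)
  have hBc : IsCompact B := isCompact_closedBall _ _
  set g : E → ℂ := B.indicator u with hg
  have hgint : Integrable g :=
    (integrable_indicator_iff hBc.measurableSet).2 ((hu.mono hRs).integrableOn_compact hBc)
  set I : ℝ := ∫ x : E, radialKernel x
  have hI : 0 < I := integral_radialKernel_pos
  set A : E → ℝ → ℂ := fun y c => ∫ x, g x *
    ((c ^ Module.finrank ℝ E * radialKernel (c • (x - y)) : ℝ) : ℂ) with hA
  have hgcont : ∀ y ∈ Metric.ball x₀ r, ContinuousAt g y := by
    intro y hy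
    have hyB : B ∈ 𝓝 y := by
      refine mem_of_superset (Metric.isOpen_ball.mem_nhds hy)
        (Metric.ball_subset_closedBall.trans (Metric.closedBall_subset_closedBall (by linarith)))
    have : g =ᶠ[𝓝 y] u := by
      filter_upwards [hyB] with z hz using indicator_of_mem hz u
    exact (hu.continuousAt (hs.mem_nhds (hRs (mem_of_mem_nhds hyB)))).congr this.symm
  -- As the scale grows, the kernels form an approximate identity up to their total mass `I`.
  have hlim : ∀ y ∈ Metric.ball x₀ r, Tendsto (A y) atTop (𝓝 ((I : ℂ) * g y)) := by
    intro y hy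
    have h1 := tendsto_integral_comp_smul_smul_of_integrable' (μ := volume)
      (φ := fun x : E => I⁻¹ * radialKernel x) (fun x => mul_nonneg (inv_pos.2 hI).le
      (radialKernel_nonneg x)) (by rw [integral_const_mul, inv_mul_cancel₀ hI.ne'])
      (tendsto_const_nhds.congr' (by
        filter_upwards [tendsto_norm_cobounded_atTop.eventually_ge_atTop 1] with x hx
        rw [radialKernel_of_one_le hx, mul_zero, mul_zero])) hgint (hgcont y hy)
    have h2 := h1.const_mul (I : ℂ)
    refine h2.congr fun c => ?_
    rw [hA, ← integral_const_mul]
    refine integral_congr_ae (Eventually.of_forall fun x => ?_)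
    have : radialKernel (c • (y - x)) = radialKernel (c • (x - y)) := by
      rw [← radialKernel_neg, ← smul_neg, neg_sub]
    have hI' : (I : ℂ) ≠ 0 := Complex.ofReal_ne_zero.2 hI.ne'
    simp only [this, Complex.real_smul]
    push_cast
    field_simp
  -- The average is constant for scales above `r⁻¹`, so its limit is already attained at any one of
  -- them; `2 * r⁻¹` is such a choice, independent of `y`.
  have hconst : ∀ y ∈ Metric.ball x₀ r, (I : ℂ) * u y = A y (2 * r⁻¹) := by
    intro y hy
    have hyB : Metric.closedBall y r ⊆ B := by
      refine Metric.closedBall_subset_closedBall' ?_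
      rw [add_le_add_iff_left]
      exact (Metric.mem_ball.1 hy).le
    have hgB : ContinuousOn g B := (hu.mono hRs).congr fun x hx => indicator_of_mem hx u
    have hd : ∀ c ∈ Ioi r⁻¹, HasDerivAt (A y) 0 c := fun c hc =>
      hasDerivAt_radialAverage hgB (fun φ h1 h2 h3 => by
        rw [← h φ h1 h2 (h3.trans hRs)]
        refine integral_congr_ae (Eventually.of_forall fun x => ?_)
        by_cases hx : x ∈ B
        · simp [hg, hx]
        · have : φ =ᶠ[𝓝 x] fun _ => 0 :=
            notMem_tsupport_iff_eventuallyEq.1 fun h' => hx (h3 h')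
          simp only [(InnerProductSpace.laplacian_congr_nhds this).eq_of_nhds,
            InnerProductSpace.laplacian_const, Pi.zero_apply, mul_zero]) hr hyB hc
    have hmem : 2 * r⁻¹ ∈ Ioi r⁻¹ := by
      have := inv_pos.2 hr
      rw [mem_Ioi]
      linarith
    have heq : ∀ c ∈ Ioi r⁻¹, A y c = A y (2 * r⁻¹) := fun c hc =>
      isOpen_Ioi.is_const_of_deriv_eq_zero isPreconnected_Ioi
        (fun c hc => (hd c hc).differentiableAt.differentiableWithinAt)
        (fun c hc => (hd c hc).deriv) hc hmem
    have := tendsto_nhds_unique (hlim y hy) (tendsto_const_nhds.congr' (by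
      filter_upwards [Ioi_mem_atTop r⁻¹] with c hc using (heq c hc).symm))
    rw [← this, hg, indicator_of_mem (hyB (Metric.mem_closedBall_self hr.le))]
  -- At a fixed scale the average is a convolution of the integrable `g` with a smooth compactly
  -- supported kernel.
  have hsmooth : ContDiff ℝ ∞ fun y => A y (2 * r⁻¹) := by
    set c := 2 * r⁻¹
    have hc : c ≠ 0 := mul_ne_zero two_ne_zero (inv_pos.2 hr).ne'
    set k : E → ℂ := fun z => ((c ^ Module.finrank ℝ E * radialKernel (c • z) : ℝ) : ℂ) with hk
    have hkc : HasCompactSupport k := by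
      have h1 : HasCompactSupport fun z : E => radialKernel (c • z) :=
        hasCompactSupport_radialKernel.comp_smul hc
      exact (h1.mul_left (f := fun _ => c ^ Module.finrank ℝ E)).comp_left Complex.ofReal_zero
    have hkd : ContDiff ℝ ∞ k := Complex.ofRealCLM.contDiff.comp (contDiff_const.mul
      (contDiff_radialKernel.comp (contDiff_const.smul contDiff_id)))
    have h1 := hkc.contDiff_convolution_right (n := ⊤) (μ := volume)
      (ContinuousLinearMap.mul ℝ ℂ) hgint.locallyIntegrable hkd
    convert h1 using 1
    funext y
    rw [convolution_def, hA]
    refine integral_congr_ae (Eventually.of_forall fun x => ?_)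
    simp only [hk, ContinuousLinearMap.mul_apply']
    rw [← radialKernel_neg, ← smul_neg, neg_sub]
  have heq : u =ᶠ[𝓝 x₀] fun y => (I : ℂ)⁻¹ * A y (2 * r⁻¹) := by
    filter_upwards [Metric.ball_mem_nhds x₀ hr] with y hy
    rw [← hconst y hy, inv_mul_cancel_left₀ (Complex.ofReal_ne_zero.2 hI.ne')]
  exact ((contDiff_const.mul hsmooth).contDiffAt.congr_of_eventuallyEq heq).contDiffWithinAt

end Weyl

/-! ### Geometry of Lipschitz domains: charts, interior of the closure, local connectedness. -/

section LipschitzDomain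

variable {d : ℕ}

/-- A bounded open interval is a Lipschitz domain. -/
theorem isLipschitzDomain_of_isConnected {Ω : Opens (EuclideanSpace ℝ (Fin 1))}
    (hΩ : IsConnected (Ω : Set (EuclideanSpace ℝ (Fin 1)))) : IsLipschitzDomain Ω := by
  intro z hz
  have hzΩ : z ∉ Ω := by
    have := hz.2
    rwa [Ω.isOpen.interior_eq] at this
  have chart : ∀ e : EuclideanSpace ℝ (Fin 1), ‖e‖ = 1 → (∀ x y, ⟪e, x⟫_ℝ = ⟪e, y⟫_ℝ → x = y) →
      (∀ x ∈ Ω, ⟪e, x⟫_ℝ < ⟪e, z⟫_ℝ) →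
      ∃ (e : EuclideanSpace ℝ (Fin 1)) (γ : EuclideanSpace ℝ (Fin 1) → ℝ) (K : ℝ≥0) (r : ℝ),
      ‖e‖ = 1 ∧ LipschitzWith K γ ∧ 0 < r ∧
      ∀ x ∈ Metric.ball z r, x ∈ Ω ↔ inner ℝ e x < γ (x - (inner ℝ e x) • e) := by
    intro e he hinj hlt
    obtain ⟨p, hp⟩ := hΩ.nonempty
    -- The graph is the single height of `z`. The radius keeps every point of the ball above the
    -- interior point `p`; a point also below `z` lies between `p` and points of `Ω` near `z`, hence
    -- in `Ω` by connectedness.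
    refine ⟨e, fun _ => ⟪e, z⟫_ℝ, 0, ⟪e, z⟫_ℝ - ⟪e, p⟫_ℝ, he, LipschitzWith.const _,
      sub_pos.2 (hlt p hp), fun x hx => ⟨hlt x, fun hxz => ?_⟩⟩
    have hpx : ⟪e, p⟫_ℝ < ⟪e, x⟫_ℝ := by
      have h1 : ⟪e, z - x⟫_ℝ ≤ ‖z - x‖ := by
        simpa [he] using real_inner_le_norm e (z - x)
      rw [Metric.mem_ball, dist_comm, dist_eq_norm] at hx
      rw [inner_sub_right] at h1
      linarith
    obtain ⟨q, hq, hqΩ⟩ := mem_closure_iff.1 hz.1 {y | ⟪e, x⟫_ℝ < ⟪e, y⟫_ℝ}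
      (isOpen_lt continuous_const (by fun_prop)) hxz
    obtain ⟨w, hw, hwx⟩ := hΩ.isPreconnected.intermediate_value hp hqΩ
      (f := fun y => ⟪e, y⟫_ℝ) (by fun_prop) ⟨hpx.le, (le_of_lt hq : ⟪e, x⟫_ℝ ≤ ⟪e, q⟫_ℝ)⟩
    rwa [← hinj w x hwx]
  set e : EuclideanSpace ℝ (Fin 1) := EuclideanSpace.single 0 1 with he
  have hinner : ∀ x, ⟪e, x⟫_ℝ = x 0 := fun x => by simp [he, EuclideanSpace.inner_single_left]
  have hinj : ∀ x y : EuclideanSpace ℝ (Fin 1), ⟪e, x⟫_ℝ = ⟪e, y⟫_ℝ → x = y := by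
    intro x y h
    ext i
    rw [Subsingleton.elim i 0, ← hinner, ← hinner, h]
  have hne : ‖e‖ = 1 := by simp [he]
  by_cases hlt : ∀ x ∈ Ω, ⟪e, x⟫_ℝ < ⟪e, z⟫_ℝ
  · exact chart e hne hinj hlt
  · push Not at hlt
    obtain ⟨p, hp, hpz⟩ := hlt
    refine chart (-e) (by simpa using hne) (fun x y h => hinj x y (by simpa using h)) ?_
    intro x hx
    by_contra hcon
    rw [inner_neg_left, inner_neg_left, not_lt, neg_le_neg_iff] at hcon
    obtain ⟨w, hw, hwx⟩ := hΩ.isPreconnected.intermediate_value hx hp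
      (f := fun y => ⟪e, y⟫_ℝ) (by fun_prop) ⟨hcon, hpz⟩
    exact hzΩ (hinj w z hwx ▸ hw)

/-- A chart exhibiting `Ω` near the boundary point `z` as the region below a Lipschitz graph. -/
structure IsLipschitzChart (Ω : Opens (EuclideanSpace ℝ (Fin d))) (z e : EuclideanSpace ℝ (Fin d))
    (γ : EuclideanSpace ℝ (Fin d) → ℝ) (K : ℝ≥0) (r : ℝ) : Prop where
  norm_eq : ‖e‖ = 1
  lipschitz : LipschitzWith K γ
  pos : 0 < r
  mem_iff : ∀ x ∈ Metric.ball z r, x ∈ Ω ↔ ⟪e, x⟫_ℝ < γ (x - ⟪e, x⟫_ℝ • e)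

namespace IsLipschitzChart

variable {Ω : Opens (EuclideanSpace ℝ (Fin d))} {z e : EuclideanSpace ℝ (Fin d)}
    {γ : EuclideanSpace ℝ (Fin d) → ℝ} {K : ℝ≥0} {r : ℝ}

theorem inner_self (h : IsLipschitzChart Ω z e γ K r) : ⟪e, e⟫_ℝ = 1 := by
  rw [real_inner_self_eq_norm_sq, h.norm_eq, one_pow]

theorem inner_add_smul (h : IsLipschitzChart Ω z e γ K r) (x : EuclideanSpace ℝ (Fin d)) (t : ℝ) :
    ⟪e, x + t • e⟫_ℝ = ⟪e, x⟫_ℝ + t := by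
  rw [inner_add_right, inner_smul_right, h.inner_self, mul_one]

theorem proj_add_smul (h : IsLipschitzChart Ω z e γ K r) (x : EuclideanSpace ℝ (Fin d)) (t : ℝ) :
    (x + t • e) - ⟪e, x + t • e⟫_ℝ • e = x - ⟪e, x⟫_ℝ • e := by
  rw [h.inner_add_smul]
  module

theorem norm_proj_le (h : IsLipschitzChart Ω z e γ K r) (x : EuclideanSpace ℝ (Fin d)) :
    ‖x - ⟪e, x⟫_ℝ • e‖ ≤ ‖x‖ := by
  refine (pow_le_pow_iff_left₀ (norm_nonneg _) (norm_nonneg _) two_ne_zero).1 ?_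
  rw [norm_sub_sq_real, inner_smul_right, norm_smul, h.norm_eq, real_inner_comm, Real.norm_eq_abs,
    mul_one, sq_abs]
  nlinarith [sq_nonneg ⟪e, x⟫_ℝ]

theorem continuous_graph (h : IsLipschitzChart Ω z e γ K r) :
    Continuous fun x : EuclideanSpace ℝ (Fin d) => γ (x - ⟪e, x⟫_ℝ • e) :=
  h.lipschitz.continuous.comp (by fun_prop)

/-- Being strictly above the graph is an open condition, and inside the ball it excludes points of
`Ω`. -/
theorem notMem_closure (h : IsLipschitzChart Ω z e γ K r) {x : EuclideanSpace ℝ (Fin d)}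
    (hx : x ∈ Metric.ball z r) (hlt : γ (x - ⟪e, x⟫_ℝ • e) < ⟪e, x⟫_ℝ) :
    x ∉ closure (Ω : Set (EuclideanSpace ℝ (Fin d))) := by
  intro hcl
  have hopen : IsOpen (Metric.ball z r ∩ {x | γ (x - ⟪e, x⟫_ℝ • e) < ⟪e, x⟫_ℝ}) :=
    Metric.isOpen_ball.inter (isOpen_lt h.continuous_graph (by fun_prop))
  obtain ⟨y, ⟨hy1, hy2⟩, hyΩ⟩ := mem_closure_iff.1 hcl _ hopen ⟨hx, hlt⟩
  exact lt_asymm hy2 ((h.mem_iff y hy1).1 hyΩ)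

theorem eq_of_mem_frontier (h : IsLipschitzChart Ω z e γ K r) {x : EuclideanSpace ℝ (Fin d)}
    (hx : x ∈ Metric.ball z r) (hfr : x ∈ frontier (Ω : Set (EuclideanSpace ℝ (Fin d)))) :
    ⟪e, x⟫_ℝ = γ (x - ⟪e, x⟫_ℝ • e) := by
  refine le_antisymm (not_lt.1 fun hlt => h.notMem_closure hx hlt hfr.1) (not_lt.1 fun hlt => ?_)
  have := hfr.2
  rw [Ω.isOpen.interior_eq] at this
  exact this ((h.mem_iff x hx).2 hlt)

theorem add_smul_mem_ball (h : IsLipschitzChart Ω z e γ K r) {t R : ℝ} (ht : |t| < R) :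
    z + t • e ∈ Metric.ball z R := by
  simpa [norm_smul, h.norm_eq] using ht

theorem add_smul_mem (h : IsLipschitzChart Ω z e γ K r)
    (hz : z ∈ frontier (Ω : Set (EuclideanSpace ℝ (Fin d)))) {t : ℝ} (ht : t < 0) (htr : -r < t) :
    z + t • e ∈ Ω := by
  rw [h.mem_iff _ (h.add_smul_mem_ball (abs_lt.2 ⟨htr, ht.trans h.pos⟩)), h.proj_add_smul,
    h.inner_add_smul, ← h.eq_of_mem_frontier (Metric.mem_ball_self h.pos) hz]
  linarith

theorem add_smul_notMem_closure (h : IsLipschitzChart Ω z e γ K r)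
    (hz : z ∈ frontier (Ω : Set (EuclideanSpace ℝ (Fin d)))) {t : ℝ} (ht : 0 < t) (htr : t < r) :
    z + t • e ∉ closure (Ω : Set (EuclideanSpace ℝ (Fin d))) := by
  refine h.notMem_closure (h.add_smul_mem_ball (abs_lt.2 ⟨by linarith [h.pos], htr⟩)) ?_
  rw [h.proj_add_smul, h.inner_add_smul,
    ← h.eq_of_mem_frontier (Metric.mem_ball_self h.pos) hz]
  linarith

end IsLipschitzChart

variable {Ω : Opens (EuclideanSpace ℝ (Fin d))}

theorem IsLipschitzDomain.exists_chart (hΩ : IsLipschitzDomain Ω) {z : EuclideanSpace ℝ (Fin d)}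
    (hz : z ∈ frontier (Ω : Set (EuclideanSpace ℝ (Fin d)))) :
    ∃ e γ K r, IsLipschitzChart Ω z e γ K r := by
  obtain ⟨e, γ, K, r, h1, h2, h3, h4⟩ := hΩ z hz
  exact ⟨e, γ, K, r, h1, h2, h3, h4⟩

/-- A Lipschitz domain is the interior of its closure. -/
theorem IsLipschitzDomain.interior_closure_subset (hΩ : IsLipschitzDomain Ω) :
    interior (closure (Ω : Set (EuclideanSpace ℝ (Fin d)))) ⊆ Ω := by
  intro z hz
  by_contra hzΩ
  have hfr : z ∈ frontier (Ω : Set (EuclideanSpace ℝ (Fin d))) := by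
    refine ⟨interior_subset hz, ?_⟩
    rwa [Ω.isOpen.interior_eq]
  obtain ⟨e, γ, K, r, h⟩ := hΩ.exists_chart hfr
  obtain ⟨ε, hε, hsub⟩ := Metric.isOpen_iff.1 isOpen_interior z hz
  -- Moving `z` up by this amount stays in the ball contained in the interior of the closure, yet
  -- lands strictly above the graph, off the closure.
  have ht : 0 < min ε r / 2 := by have := h.pos; positivity
  have h1 : min ε r / 2 < ε := by have := min_le_left ε r; linarith
  have h2 : min ε r / 2 < r := by have := min_le_right ε r; linarith
  exact h.add_smul_notMem_closure hfr ht h2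
    (interior_subset (hsub (h.add_smul_mem_ball (by rwa [abs_of_pos ht]))))

/-- Points of a Lipschitz domain close to a given boundary point can be joined within the domain
and close to that boundary point. -/
theorem IsLipschitzDomain.exists_isPreconnected (hΩ : IsLipschitzDomain Ω)
    {z : EuclideanSpace ℝ (Fin d)} (hz : z ∈ frontier (Ω : Set (EuclideanSpace ℝ (Fin d))))
    {R : ℝ} (hR : 0 < R) :
    ∃ ρ > 0, ∀ y ∈ (Ω : Set (EuclideanSpace ℝ (Fin d))) ∩ Metric.ball z ρ,
      ∀ y' ∈ (Ω : Set (EuclideanSpace ℝ (Fin d))) ∩ Metric.ball z ρ,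
      ∃ C ⊆ (Ω : Set (EuclideanSpace ℝ (Fin d))) ∩ Metric.ball z R,
        IsPreconnected C ∧ y ∈ C ∧ y' ∈ C := by
  obtain ⟨e, γ, K, r, h⟩ := hΩ.exists_chart hz
  have hr := h.pos
  -- Two points of the `ρ`-ball differ by at most `2ρ` in height, and the graph heights over them by
  -- at most `2Kρ`. Lowering by `T = 2(1 + K)ρ` therefore puts the whole segment between them below
  -- the graph, and the path down, across and up stays in the ball of radius `ρ + T`.
  obtain ⟨ρ, hρ, hρR⟩ : ∃ ρ : ℝ, 0 < ρ ∧ ρ + 2 * (1 + K) * ρ < min R r := by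
    have hm : 0 < min R r := lt_min hR hr
    have hK : (0 : ℝ) < 3 + 2 * K := by positivity
    refine ⟨min R r / 2 / (3 + 2 * K), by positivity, ?_⟩
    have : min R r / 2 / (3 + 2 * K) * (3 + 2 * K) = min R r / 2 := div_mul_cancel₀ _ hK.ne'
    linarith
  set T : ℝ := 2 * (1 + K) * ρ with hT
  have hT0 : 0 < T := by positivity
  refine ⟨ρ, hρ, ?_⟩
  have ball_sub : ∀ {x}, x ∈ Metric.ball z (ρ + T) → x ∈ Metric.ball z r := fun hx =>
    Metric.ball_subset_ball (hρR.le.trans (min_le_right _ _)) hx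
  have ball_sub' : ∀ {x}, x ∈ Metric.ball z (ρ + T) → x ∈ Metric.ball z R := fun hx =>
    Metric.ball_subset_ball (hρR.le.trans (min_le_left _ _)) hx
  have shift : ∀ x ∈ Metric.ball z ρ, ∀ t ∈ Icc 0 T, x + (-t) • e ∈ Metric.ball z (ρ + T) := by
    intro x hx t ht
    rw [Metric.mem_ball, dist_eq_norm] at hx ⊢
    calc ‖x + (-t) • e - z‖ = ‖(x - z) + (-t) • e‖ := by congr 1; module
      _ ≤ ‖x - z‖ + ‖(-t) • e‖ := norm_add_le _ _
      _ = ‖x - z‖ + t := by rw [norm_smul, h.norm_eq, norm_neg, Real.norm_of_nonneg ht.1, mul_one]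
      _ < ρ + T := by linarith [ht.2]
  have down : ∀ x ∈ (Ω : Set (EuclideanSpace ℝ (Fin d))) ∩ Metric.ball z ρ, ∀ t ∈ Icc 0 T,
      x + (-t) • e ∈ Ω := by
    intro x hx t ht
    rw [h.mem_iff _ (ball_sub (shift x hx.2 t ht)), h.proj_add_smul, h.inner_add_smul]
    have hxr : x ∈ Metric.ball z r :=
      ball_sub (Metric.ball_subset_ball (by linarith) hx.2)
    have := (h.mem_iff x hxr).1 hx.1
    linarith [ht.1]
  have vert : ∀ x ∈ (Ω : Set (EuclideanSpace ℝ (Fin d))) ∩ Metric.ball z ρ,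
      segment ℝ x (x + (-T) • e) ⊆ (Ω : Set (EuclideanSpace ℝ (Fin d))) ∩ Metric.ball z R := by
    intro x hx w hw
    rw [segment_eq_image'] at hw
    obtain ⟨θ, hθ, rfl⟩ := hw
    have e1 : x + θ • (x + (-T) • e - x) = x + (-(θ * T)) • e := by module
    have hθT : θ * T ∈ Icc 0 T :=
      ⟨mul_nonneg hθ.1 hT0.le, mul_le_of_le_one_left hT0.le hθ.2⟩
    simp only [e1]
    exact ⟨down x hx _ hθT, ball_sub' (shift x hx.2 _ hθT)⟩
  intro y hy y' hy'
  have horiz : segment ℝ (y + (-T) • e) (y' + (-T) • e) ⊆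
      (Ω : Set (EuclideanSpace ℝ (Fin d))) ∩ Metric.ball z R := by
    intro w hw
    rw [segment_eq_image'] at hw
    obtain ⟨θ, hθ, rfl⟩ := hw
    set x := y + θ • (y' - y) with hx
    have e1 : y + (-T) • e + θ • (y' + (-T) • e - (y + (-T) • e)) = x + (-T) • e := by
      rw [hx]; module
    have hxρ : x ∈ Metric.ball z ρ := by
      have := (convex_ball z ρ).segment_subset hy.2 hy'.2
      exact this (by rw [segment_eq_image']; exact ⟨θ, hθ, rfl⟩)
    have hT' : T ∈ Icc 0 T := ⟨hT0.le, le_rfl⟩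
    have hb := shift x hxρ T hT'
    simp only [e1]
    refine ⟨?_, ball_sub' hb⟩
    change x + (-T) • e ∈ Ω
    rw [h.mem_iff _ (ball_sub hb), h.proj_add_smul, h.inner_add_smul]
    have hyr := (h.mem_iff y (ball_sub (Metric.ball_subset_ball (by linarith) hy.2))).1 hy.1
    have hdist : ‖x - y‖ ≤ 2 * ρ := by
      have h1 := Metric.mem_ball.1 hxρ
      have h2 := Metric.mem_ball'.1 hy.2
      rw [← dist_eq_norm]
      linarith [dist_triangle x z y]
    have hip : ⟪e, x⟫_ℝ - ⟪e, y⟫_ℝ ≤ 2 * ρ := by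
      rw [← inner_sub_right]
      refine (real_inner_le_norm _ _).trans ?_
      rwa [h.norm_eq, one_mul]
    have hγ : γ (y - ⟪e, y⟫_ℝ • e) - γ (x - ⟪e, x⟫_ℝ • e) ≤ K * (2 * ρ) := by
      have h1 := h.lipschitz.dist_le_mul (y - ⟪e, y⟫_ℝ • e) (x - ⟪e, x⟫_ℝ • e)
      have h2 : dist (y - ⟪e, y⟫_ℝ • e) (x - ⟪e, x⟫_ℝ • e) ≤ 2 * ρ := by
        rw [dist_comm, dist_eq_norm]
        refine le_trans (le_of_eq ?_) ((h.norm_proj_le (x - y)).trans hdist)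
        rw [inner_sub_right]
        congr 1
        module
      rw [Real.dist_eq] at h1
      exact (le_abs_self _).trans (h1.trans (by gcongr))
    rw [hT]
    linarith
  refine ⟨segment ℝ y (y + (-T) • e) ∪ segment ℝ (y + (-T) • e) (y' + (-T) • e) ∪
    segment ℝ y' (y' + (-T) • e), union_subset (union_subset (vert y hy) horiz) (vert y' hy'),
    ?_, Or.inl (Or.inl (left_mem_segment ℝ _ _)), Or.inr (left_mem_segment ℝ _ _)⟩
  refine IsPreconnected.union (y' + (-T) • e) (Or.inr (right_mem_segment ℝ _ _))
    (right_mem_segment ℝ _ _) (IsPreconnected.union (y + (-T) • e) (right_mem_segment ℝ _ _)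
    (left_mem_segment ℝ _ _) (convex_segment _ _).isPreconnected
    (convex_segment _ _).isPreconnected) (convex_segment _ _).isPreconnected

end LipschitzDomain

/-! ### The indicator function and the surface measure near a Lipschitz boundary. -/

section LipschitzBoundary

variable {d : ℕ} {Ω : Opens (EuclideanSpace ℝ (Fin d))}

/-- Near a Lipschitz boundary point, the distributional derivative of the indicator function of the
domain does not vanish. -/
theorem IsLipschitzDomain.exists_not_integral_fderiv_eq_zero (hΩ : IsLipschitzDomain Ω)
    {z : EuclideanSpace ℝ (Fin d)} (hz : z ∈ frontier (Ω : Set (EuclideanSpace ℝ (Fin d))))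
    {R : ℝ} (hR : 0 < R) :
    ∃ e : EuclideanSpace ℝ (Fin d), ¬ ∀ v : EuclideanSpace ℝ (Fin d) → ℂ, ContDiff ℝ ∞ v →
      HasCompactSupport v → tsupport v ⊆ Metric.ball z R →
      ∫ x in (Ω : Set (EuclideanSpace ℝ (Fin d))), fderiv ℝ v x e = 0 := by
  obtain ⟨e, γ, K, r, h⟩ := hΩ.exists_chart hz
  have hr := h.pos
  refine ⟨e, fun hv => ?_⟩
  -- If the derivative vanished, the integral over `Ω` of a bump translated along `e` would be
  -- constant. At `z - s e` the bump lies inside `Ω` and the integral is its full mass; at `z + s e`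
  -- it lies outside the closure and the integral is zero.
  obtain ⟨s, hs, hsR, hsr⟩ : ∃ s : ℝ, 0 < s ∧ s < R ∧ s < r := by
    obtain ⟨s, hs, hs'⟩ := exists_between (lt_min hR hr)
    exact ⟨s, hs, hs'.trans_le (min_le_left _ _), hs'.trans_le (min_le_right _ _)⟩
  have hin : z + (-s) • e ∈ Ω := h.add_smul_mem hz (by linarith) (by linarith)
  have hout : z + s • e ∈ (closure (Ω : Set (EuclideanSpace ℝ (Fin d))))ᶜ :=
    h.add_smul_notMem_closure hz hs hsr
  obtain ⟨η₁, hη₁, hin'⟩ := Metric.isOpen_iff.1 Ω.isOpen _ hin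
  obtain ⟨η₂, hη₂, hout'⟩ := Metric.isOpen_iff.1 isClosed_closure.isOpen_compl _ hout
  -- The open parameter interval `(-s', s')` contains `±s`. Taking `η < R - s'` keeps every
  -- translated bump inside `ball z R`, while `η < η₁` and `η < η₂` settle the two end positions.
  obtain ⟨s', hs', hs'R⟩ := exists_between hsR
  obtain ⟨η, hη, hη'⟩ := exists_between (lt_min (lt_min hη₁ hη₂) (sub_pos.2 hs'R))
  have hηη₁ : η < η₁ := hη'.trans_le ((min_le_left _ _).trans (min_le_left _ _))
  have hηη₂ : η < η₂ := hη'.trans_le ((min_le_left _ _).trans (min_le_right _ _))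
  have hηR : η < R - s' := hη'.trans_le (min_le_right _ _)
  let b : ContDiffBump (0 : EuclideanSpace ℝ (Fin d)) := ⟨η / 2, η, by positivity, by linarith⟩
  have hb : ∀ w, η ≤ ‖w‖ → b w = 0 := fun w hw => b.zero_of_le_dist (by simpa using hw)
  set k : ℝ → EuclideanSpace ℝ (Fin d) → ℂ := fun t x => ((b (x - (z + t • e)) : ℝ) : ℂ) with hk
  have hbd : ContDiff ℝ ∞ fun w => ((b w : ℝ) : ℂ) := Complex.ofRealCLM.contDiff.comp b.contDiff
  have hkd : ∀ t, ContDiff ℝ ∞ (k t) := fun t => hbd.comp (contDiff_id.sub contDiff_const)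
  have hksupp : ∀ t ∈ Ioo (-s') s', ∀ x ∉ Metric.closedBall z (s' + η), k t x = 0 := by
    intro t ht x hx
    rw [Metric.mem_closedBall, not_le, dist_eq_norm] at hx
    have h1 : ‖x - z‖ ≤ ‖x - (z + t • e)‖ + ‖t • e‖ := by
      refine le_trans (le_of_eq ?_) (norm_add_le _ _)
      congr 1
      module
    rw [norm_smul, h.norm_eq, mul_one, Real.norm_eq_abs] at h1
    have h2 := abs_lt.2 ht
    simp only [hk]
    rw [hb _ (by linarith), Complex.ofReal_zero]
  have htsupp : ∀ t ∈ Ioo (-s') s', tsupport (k t) ⊆ Metric.closedBall z (s' + η) := fun t ht =>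
    closure_minimal (fun x hx => by_contra fun h' =>
      (Function.mem_support.1 hx) (hksupp t ht x h')) Metric.isClosed_closedBall
  have hsub : Metric.closedBall z (s' + η) ⊆ Metric.ball z R :=
    Metric.closedBall_subset_ball (by linarith)
  have hfd : ∀ t x, fderiv ℝ (k t) x = fderiv ℝ (fun w => ((b w : ℝ) : ℂ)) (x - (z + t • e)) :=
    fun t x => fderiv_comp_sub (f := fun w => ((b w : ℝ) : ℂ)) (z + t • e)
  have hzero : ∀ t ∈ Ioo (-s') s',
      ∫ x in (Ω : Set (EuclideanSpace ℝ (Fin d))), 1 * -fderiv ℝ (k t) x e = 0 := by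
    intro t ht
    simp_rw [one_mul]
    rw [integral_neg, hv (k t) (hkd t) (HasCompactSupport.intro (isCompact_closedBall _ _)
      (hksupp t ht)) ((htsupp t ht).trans hsub), neg_zero]
  have hderiv : ∀ t ∈ Ioo (-s') s', HasDerivAt
      (fun t => ∫ x in (Ω : Set (EuclideanSpace ℝ (Fin d))), 1 * k t x) 0 t := by
    intro t ht
    rw [← hzero t ht]
    refine hasDerivAt_integral_mul_of_compact (u := fun _ => 1)
      (k' := fun t x => -fderiv ℝ (k t) x e)
      (isCompact_closedBall z (s' + η)) (continuousOn_const.integrableOn_compact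
      (isCompact_closedBall _ _)) (Ioo_mem_nhds ht.1 ht.2) (fun t _ => (hkd t).continuous)
      ?_ ?_ hksupp ?_
    · refine Continuous.continuousOn ?_
      simp only [Function.uncurry_def, hfd]
      have := hbd.continuous_fderiv (by simp)
      fun_prop
    · intro t _ x
      have h1 : HasDerivAt (fun t : ℝ => x - (z + t • e)) (-e) t := by
        simpa using (((hasDerivAt_id t).smul_const e).const_add z).const_sub x
      have h2 := (hbd.differentiable (by simp) (x - (z + t • e))).hasFDerivAt.comp_hasDerivAt t h1
      rw [hfd, ← map_neg]
      exact h2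
    · intro t ht x hx
      have : k t =ᶠ[𝓝 x] fun _ => 0 :=
        notMem_tsupport_iff_eventuallyEq.1 fun h' => hx (htsupp t ht h')
      simp [this.fderiv_eq]
  have hs'0 : 0 < s' := hs.trans hs'
  have heq := isOpen_Ioo.is_const_of_deriv_eq_zero isPreconnected_Ioo
    (fun t ht => (hderiv t ht).differentiableAt.differentiableWithinAt)
    (fun t ht => (hderiv t ht).deriv) (x := -s) (y := s)
    ⟨by linarith, by linarith⟩ ⟨by linarith, by linarith⟩
  have hright : ∫ x in (Ω : Set (EuclideanSpace ℝ (Fin d))), 1 * k s x = 0 := by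
    refine setIntegral_eq_zero_of_forall_eq_zero fun x hx => ?_
    have hxb : x ∉ Metric.ball (z + s • e) η₂ := fun h' => hout' h' (subset_closure hx)
    rw [Metric.mem_ball, not_lt, dist_eq_norm] at hxb
    simp only [hk]
    rw [hb _ (by linarith), Complex.ofReal_zero, mul_zero]
  have hleft : ∫ x in (Ω : Set (EuclideanSpace ℝ (Fin d))), 1 * k (-s) x =
      ((∫ x, b x : ℝ) : ℂ) := by
    rw [setIntegral_eq_integral_of_forall_compl_eq_zero]
    · simp only [one_mul, hk]
      rw [integral_sub_right_eq_self (fun w => ((b w : ℝ) : ℂ)), integral_complex_ofReal]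
    · intro x hx
      have hxb : x ∉ Metric.ball (z + (-s) • e) η₁ := fun h' => hx (hin' h')
      rw [Metric.mem_ball, not_lt, dist_eq_norm] at hxb
      simp only [hk]
      rw [hb _ (by linarith), Complex.ofReal_zero, mul_zero]
  rw [hright, hleft] at heq
  exact b.integral_pos.ne' (Complex.ofReal_eq_zero.1 heq)

/-- The surface measure of a Lipschitz domain is locally finite. -/
theorem IsLipschitzDomain.isLocallyFiniteMeasure (hΩ : IsLipschitzDomain Ω) :
    IsLocallyFiniteMeasure (surfaceMeasure Ω) := by
  refine ⟨fun z => ?_⟩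
  by_cases hz : z ∈ frontier (Ω : Set (EuclideanSpace ℝ (Fin d)))
  swap
  · refine ⟨(frontier (Ω : Set (EuclideanSpace ℝ (Fin d))))ᶜ,
      isClosed_frontier.isOpen_compl.mem_nhds hz, ?_⟩
    rw [surfaceMeasure, Measure.restrict_apply isClosed_frontier.measurableSet.compl]
    simp
  obtain ⟨e, γ, K, r, h⟩ := hΩ.exists_chart hz
  refine ⟨Metric.ball z r, Metric.ball_mem_nhds z h.pos, ?_⟩
  rw [surfaceMeasure, Measure.restrict_apply Metric.isOpen_ball.measurableSet]
  -- The boundary near `z` lies in the image of a bounded subset of the `(d - 1)`-dimensional space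
  -- `V` under the Lipschitz graph map `Φ`, so its Hausdorff measure is finite.
  set V : Submodule ℝ (EuclideanSpace ℝ (Fin d)) := (ℝ ∙ e)ᗮ with hV
  have hrank : Module.finrank ℝ V = d - 1 := by
    have he : e ≠ 0 := norm_ne_zero_iff.1 (by rw [h.norm_eq]; exact one_ne_zero)
    have h1 := Submodule.finrank_add_finrank_orthogonal (ℝ ∙ e)
    rw [finrank_span_singleton he, finrank_euclideanSpace_fin] at h1
    rw [hV]
    omega
  let Φ : V → EuclideanSpace ℝ (Fin d) := fun p => p + γ p • e
  have hΦ : LipschitzWith (1 + K) Φ := by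
    refine LipschitzWith.of_dist_le_mul fun p q => ?_
    have e1 : dist (Φ p) (Φ q) ≤ dist p q + dist (γ p) (γ q) := by
      refine (dist_add_add_le _ _ _ _).trans ?_
      rw [dist_eq_norm (γ p • e), ← sub_smul, norm_smul, h.norm_eq, mul_one, ← dist_eq_norm]
      rfl
    have e2 := h.lipschitz.dist_le_mul p q
    have e3 : dist (p : EuclideanSpace ℝ (Fin d)) q = dist p q := rfl
    rw [e3] at e2
    push_cast
    linarith
  have hsub : Metric.ball z r ∩ frontier (Ω : Set (EuclideanSpace ℝ (Fin d))) ⊆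
      Φ '' Metric.closedBall 0 (‖z‖ + r) := by
    intro x hx
    have hmem : x - ⟪e, x⟫_ℝ • e ∈ V := by
      rw [hV, Submodule.mem_orthogonal_singleton_iff_inner_right, inner_sub_right,
        inner_smul_right, h.inner_self, mul_one, sub_self]
    refine ⟨⟨_, hmem⟩, ?_, ?_⟩
    · rw [mem_closedBall_zero_iff]
      refine (h.norm_proj_le x).trans ?_
      have := norm_sub_norm_le x z
      have h2 := mem_ball_iff_norm.1 hx.1
      linarith
    · change x - ⟪e, x⟫_ℝ • e + γ (x - ⟪e, x⟫_ℝ • e) • e = x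
      rw [← h.eq_of_mem_frontier hx.1 hx.2]
      module
  refine (measure_mono hsub).trans_lt ?_
  have h1 := hΦ.hausdorffMeasure_image_le (d := ((d - 1 : ℕ) : ℝ)) (by positivity)
    (Metric.closedBall 0 (‖z‖ + r))
  have h2 := (Metric.isBounded_closedBall (x := (0 : V)) (r := ‖z‖ + r)).measure_lt_top
    (μ := μH[Module.finrank ℝ V])
  rw [hrank] at h2
  rw [Measure.euclideanHausdorffMeasure_def, Measure.smul_apply]
  refine ENNReal.mul_lt_top (by simp) (h1.trans_lt (ENNReal.mul_lt_top ?_ h2))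
  exact ENNReal.rpow_lt_top_of_nonneg (by positivity) (by simp)

end LipschitzBoundary

/-! ### Disjointness preserving functionals on `C(X, ℂ)`. -/

section DisjointnessPreserving

variable {X : Type*} [TopologicalSpace X] [CompactSpace X] [T2Space X]

/-- The closed ideal of all functions annihilated by `Λ` together with their multiples. -/
def annihilatedIdeal (Λ : C(X, ℂ) →L[ℂ] ℂ) : Ideal C(X, ℂ) where
  carrier := {f | ∀ g, Λ (f * g) = 0}
  add_mem' hf hf' g := by rw [add_mul, map_add, hf g, hf' g, add_zero]
  zero_mem' g := by rw [zero_mul, map_zero]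
  smul_mem' c f hf g := by
    rw [smul_eq_mul, mul_comm c f, mul_assoc]
    exact hf _

theorem isClosed_annihilatedIdeal (Λ : C(X, ℂ) →L[ℂ] ℂ) :
    IsClosed (annihilatedIdeal Λ : Set C(X, ℂ)) := by
  have : (annihilatedIdeal Λ : Set C(X, ℂ)) = ⋂ g, {f | Λ (f * g) = 0} := by
    ext f
    rw [mem_iInter]
    rfl
  rw [this]
  exact isClosed_iInter fun g => isClosed_eq (by fun_prop) continuous_const

/-- A disjointness preserving functional on `C(X, ℂ)` is a multiple of a point evaluation. -/
theorem exists_eq_mul_eval [Nonempty X] (Λ : C(X, ℂ) →L[ℂ] ℂ)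
    (h : ∀ f g : C(X, ℂ), f * g = 0 → Λ f * Λ g = 0) : ∃ x, ∀ f, Λ f = Λ 1 * f x := by
  set I := annihilatedIdeal Λ with hI
  -- A closed ideal of `C(X, ℂ)` consists of all functions vanishing on its common zero set. For `Λ
  -- ≠ 0` this set turns out to be a single point, the one at which `Λ` evaluates.
  have hclosed := ContinuousMap.idealOfSet_ofIdeal_isClosed (isClosed_annihilatedIdeal Λ)
  by_cases hone : (1 : C(X, ℂ)) ∈ I
  · have hzero : ∀ f, Λ f = 0 := fun f => by simpa using hone f
    exact ⟨Classical.arbitrary X, fun f => by rw [hzero, hzero, zero_mul]⟩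
  obtain ⟨x, hx⟩ : ∃ x, x ∈ (ContinuousMap.setOfIdeal I)ᶜ := by
    by_contra hcon
    push Not at hcon
    refine hone ?_
    rw [hI, ← hclosed, ContinuousMap.mem_idealOfSet]
    exact fun x hx => (hcon x hx).elim
  have bump : ∀ x : X, ∀ s : Set X, IsOpen s → x ∈ s →
      ∃ f : C(X, ℂ), f x = 1 ∧ ∀ y ∉ s, f y = 0 := by
    intro x s hs hxs
    obtain ⟨f, hf0, hf1, -⟩ := exists_continuous_zero_one_of_isClosed hs.isClosed_compl
      isClosed_singleton (disjoint_singleton_right.2 fun h' => h' hxs)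
    refine ⟨⟨fun y => (f y : ℂ), by fun_prop⟩, ?_, fun y hy => ?_⟩
    · have := hf1 (mem_singleton x)
      simp only [Pi.one_apply] at this
      simp [this]
    · have := hf0 hy
      simp only [Pi.zero_apply] at this
      simp [this]
  -- Disjoint bumps at two common zeros cannot lie in the ideal, so each has a multiple on which `Λ`
  -- is nonzero; these multiples still have product zero, against the hypothesis.
  have huniq : ∀ x' ∈ (ContinuousMap.setOfIdeal I)ᶜ, x' = x := by
    intro x' hx'
    by_contra hne
    obtain ⟨s, t, hs, ht, hxs, hxt, hst⟩ := t2_separation hne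
    obtain ⟨f, hf1, hf0⟩ := bump x' s hs hxs
    obtain ⟨g, hg1, hg0⟩ := bump x t ht hxt
    have hfg : f * g = 0 := by
      ext y
      by_cases hy : y ∈ s
      · simp [hg0 y fun h' => hst.le_bot ⟨hy, h'⟩]
      · simp [hf0 y hy]
    have hor : f ∈ I ∨ g ∈ I := by
      by_contra hcon
      push Not at hcon
      obtain ⟨h1, h2⟩ := hcon
      obtain ⟨f', hf'⟩ := not_forall.1 h1
      obtain ⟨g', hg'⟩ := not_forall.1 h2
      refine mul_ne_zero hf' hg' (h _ _ ?_)
      rw [mul_mul_mul_comm, hfg, zero_mul]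
    rcases hor with hf | hg
    · have := ContinuousMap.notMem_setOfIdeal.1 hx' hf
      rw [hf1] at this
      exact one_ne_zero this
    · have := ContinuousMap.notMem_setOfIdeal.1 hx hg
      rw [hg1] at this
      exact one_ne_zero this
  refine ⟨x, fun f => ?_⟩
  have hmem : f - algebraMap ℂ C(X, ℂ) (f x) ∈ I := by
    rw [hI, ← hclosed, ContinuousMap.mem_idealOfSet]
    intro y hy
    rw [huniq y hy]
    simp
  have := hmem 1
  rw [mul_one, map_sub, Algebra.algebraMap_eq_smul_one, map_smul, sub_eq_zero] at this
  rw [this, smul_eq_mul, mul_comm]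

end DisjointnessPreserving

/-! ### Local rigidity: intertwining the Laplacians forces an isometry and a locally constant
weight. -/

section LocalStructure

set_option linter.unusedSectionVars false

variable {E : Type*} [NormedAddCommGroup E] [InnerProductSpace ℝ E] [FiniteDimensional ℝ E]

/-- The linear functional `⟪a, ·⟫`, with values in `ℂ`. -/
def innerC (a : E) : E →L[ℝ] ℂ := Complex.ofRealCLM ∘L innerSL ℝ a

theorem innerC_apply (a x : E) : innerC a x = (⟪a, x⟫_ℝ : ℂ) := rfl

theorem laplacian_innerC (a x : E) : Laplacian.laplacian (fun x => innerC a x) x = 0 := by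
  have h : fderiv ℝ (fun x => innerC a x) = fun _ => innerC a := by
    funext y
    exact (innerC a).fderiv
  rw [laplacian_eq_sum_fderiv (stdOrthonormalBasis ℝ E), h]
  simp

theorem sum_innerC_sq {ι : Type*} [Fintype ι] (b : OrthonormalBasis ι ℝ E) (a : E) :
    ∑ i, innerC a (b i) * innerC a (b i) = ((‖a‖ ^ 2 : ℝ) : ℂ) := by
  rw [← b.sum_sq_norm_inner_left a]
  simp only [innerC_apply, Real.norm_eq_abs, sq_abs]
  push_cast
  exact Finset.sum_congr rfl fun i _ => by rw [pow_two]

theorem laplacian_innerC_sq (a x : E) :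
    Laplacian.laplacian (fun x => innerC a x * innerC a x) x = 2 * ((‖a‖ ^ 2 : ℝ) : ℂ) := by
  set b := stdOrthonormalBasis ℝ E
  rw [laplacian_mul b (innerC a).contDiff.contDiffAt (innerC a).contDiff.contDiffAt,
    laplacian_innerC, ← sum_innerC_sq b a]
  simp

variable [MeasurableSpace E] [BorelSpace E] {Ω₁ Ω₂ : Opens E} {W : Set E} {H : E → ℂ} {T : E → E}

/-- Localisation of the weak intertwining relation: test functions may be replaced by arbitrary
smooth functions. -/
theorem exists_ball_integral_eq (hW : IsOpen W) (hWΩ : W ⊆ Ω₂) (hT : ContinuousOn T W)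
    (hmaps : MapsTo T W Ω₁)
    (hdistr : ∀ (f : 𝓓(Ω₁, ℂ)) (φ : 𝓓(Ω₂, ℂ)),
      ∫ x in (Ω₂ : Set E), H x * f (T x) * Laplacian.laplacian (φ : E → ℂ) x =
        ∫ x in (Ω₂ : Set E), H x * Laplacian.laplacian (f : E → ℂ) (T x) * φ x)
    {y : E} (hy : y ∈ W) :
    ∃ ρ > 0, Metric.ball y ρ ⊆ W ∧ ∀ p : E → ℂ, ContDiff ℝ ∞ p →
      ∀ φ : E → ℂ, ContDiff ℝ ∞ φ → HasCompactSupport φ → tsupport φ ⊆ Metric.ball y ρ →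
      ∫ x, H x * p (T x) * Laplacian.laplacian φ x =
        ∫ x, H x * Laplacian.laplacian p (T x) * φ x := by
  obtain ⟨R, hR, hRΩ⟩ := Metric.nhds_basis_closedBall.mem_iff.1 (Ω₁.isOpen.mem_nhds (hmaps hy))
  -- Multiplying `p` by `b` makes it a test function on `Ω₁`. The radius `ρ` is chosen so that `T`
  -- maps `ball y ρ` to where `b = 1`, so the cut-off is invisible to `φ`.
  let b : ContDiffBump (T y) := ⟨R / 2, R, by positivity, by linarith⟩
  have hpre : T ⁻¹' Metric.ball (T y) (R / 2) ∈ 𝓝 y :=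
    (hT.continuousAt (hW.mem_nhds hy)).preimage_mem_nhds (Metric.ball_mem_nhds _ (by positivity))
  obtain ⟨ρ, hρ, hρsub⟩ := Metric.mem_nhds_iff.1 (inter_mem (hW.mem_nhds hy) hpre)
  refine ⟨ρ, hρ, fun x hx => (hρsub hx).1, fun p hp φ hφ hc hsub => ?_⟩
  have hbts : tsupport (fun x => ((b x : ℝ) : ℂ) * p x) ⊆ Metric.closedBall (T y) R := by
    refine closure_minimal (fun x hx => ?_) Metric.isClosed_closedBall
    have h1 : b x ≠ 0 := fun h0 => hx (by simp [h0])
    have h2 : x ∈ Function.support b := h1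
    rw [b.support_eq] at h2
    exact Metric.ball_subset_closedBall h2
  let f : 𝓓(Ω₁, ℂ) := ⟨fun x => ((b x : ℝ) : ℂ) * p x,
    (Complex.ofRealCLM.contDiff.comp b.contDiff).mul hp,
    HasCompactSupport.of_support_subset_isCompact (isCompact_closedBall (T y) R)
      (subset_closure.trans hbts), hbts.trans hRΩ⟩
  let ψ : 𝓓(Ω₂, ℂ) := ⟨φ, hφ, hc, hsub.trans (fun x hx => hWΩ (hρsub hx).1)⟩
  have hfp : ∀ x ∈ Metric.ball y ρ, (f : E → ℂ) =ᶠ[𝓝 (T x)] p := by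
    intro x hx
    filter_upwards [Metric.isOpen_ball.mem_nhds (hρsub hx).2] with w hw
    have : b w = 1 := b.one_of_mem_closedBall (Metric.ball_subset_closedBall hw)
    change ((b w : ℝ) : ℂ) * p w = p w
    rw [this, Complex.ofReal_one, one_mul]
  have hφ0 : ∀ x ∉ Metric.ball y ρ, φ =ᶠ[𝓝 x] fun _ => 0 := fun x hx =>
    notMem_tsupport_iff_eventuallyEq.1 fun h' => hx (hsub h')
  have key := hdistr f ψ
  rw [setIntegral_eq_integral_of_forall_compl_eq_zero,
    setIntegral_eq_integral_of_forall_compl_eq_zero] at key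
  · convert key using 1 <;> refine integral_congr_ae (Eventually.of_forall fun x => ?_)
    · by_cases hx : x ∈ Metric.ball y ρ
      · simp only [(hfp x hx).eq_of_nhds]
        rfl
      · change _ = H x * f (T x) * Laplacian.laplacian φ x
        simp [(InnerProductSpace.laplacian_congr_nhds (hφ0 x hx)).eq_of_nhds]
    · by_cases hx : x ∈ Metric.ball y ρ
      · simp only [(InnerProductSpace.laplacian_congr_nhds (hfp x hx)).eq_of_nhds]
        rfl
      · change _ = H x * Laplacian.laplacian (f : E → ℂ) (T x) * φ x
        simp [(hφ0 x hx).eq_of_nhds]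
  · intro x hx
    have : ψ x = 0 := (hφ0 x fun h' => hx (hWΩ (hρsub h').1)).eq_of_nhds
    rw [this, mul_zero]
  · intro x hx
    change H x * f (T x) * Laplacian.laplacian φ x = 0
    have := hφ0 x fun h' => hx (hWΩ (hρsub h').1)
    simp [(InnerProductSpace.laplacian_congr_nhds this).eq_of_nhds]

/-- The local consequences of the weak intertwining relation. -/
theorem exists_ball_laplacian_eq [Nontrivial E] (hW : IsOpen W) (hWΩ : W ⊆ Ω₂)
    (hH : ContinuousOn H W) (hT : ContinuousOn T W) (hH0 : ∀ x ∈ W, H x ≠ 0)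
    (hmaps : MapsTo T W Ω₁)
    (hdistr : ∀ (f : 𝓓(Ω₁, ℂ)) (φ : 𝓓(Ω₂, ℂ)),
      ∫ x in (Ω₂ : Set E), H x * f (T x) * Laplacian.laplacian (φ : E → ℂ) x =
        ∫ x in (Ω₂ : Set E), H x * Laplacian.laplacian (f : E → ℂ) (T x) * φ x)
    {y : E} (hy : y ∈ W) :
    ContDiffAt ℝ ∞ H y ∧ ContDiffAt ℝ ∞ T y ∧ Laplacian.laplacian H y = 0 ∧
      ∀ a, Laplacian.laplacian (fun x => H x * innerC a (T x)) y = 0 ∧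
        Laplacian.laplacian (fun x => H x * innerC a (T x) * innerC a (T x)) y =
          2 * ((‖a‖ ^ 2 : ℝ) : ℂ) * H y := by
  obtain ⟨ρ, hρ, hρW, hint⟩ := exists_ball_integral_eq hW hWΩ hT hmaps hdistr hy
  set B := Metric.ball y ρ
  have hB : IsOpen B := Metric.isOpen_ball
  have hyB : y ∈ B := Metric.mem_ball_self hρ
  have hHB : ContinuousOn H B := hH.mono hρW
  have hTB : ContinuousOn T B := hT.mono hρW
  have hweakH : ∀ φ : E → ℂ, ContDiff ℝ ∞ φ → HasCompactSupport φ → tsupport φ ⊆ B →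
      ∫ x, H x * Laplacian.laplacian φ x = 0 := fun φ h1 h2 h3 => by
    simpa using hint (fun _ => 1) contDiff_const φ h1 h2 h3
  have hHs : ContDiffOn ℝ ∞ H B := contDiffOn_of_weakly_harmonic hB hHB hweakH
  have hcontL : ∀ a, ContinuousOn (fun x => H x * innerC a (T x)) B := fun a =>
    hHB.mul ((innerC a).continuous.comp_continuousOn hTB)
  have hweakL : ∀ a, ∀ φ : E → ℂ, ContDiff ℝ ∞ φ → HasCompactSupport φ → tsupport φ ⊆ B →
      ∫ x, H x * innerC a (T x) * Laplacian.laplacian φ x = 0 := fun a φ h1 h2 h3 => by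
    simpa [laplacian_innerC] using hint (fun x => innerC a x) (innerC a).contDiff φ h1 h2 h3
  have hLs : ∀ a, ContDiffOn ℝ ∞ (fun x => H x * innerC a (T x)) B := fun a =>
    contDiffOn_of_weakly_harmonic hB (hcontL a) (hweakL a)
  -- The components of `T` are quotients of the smooth functions `H ⟨a, T⟩` and `H`, and `H` does
  -- not vanish.
  have hTL : ∀ a, ContDiffOn ℝ ∞ (fun x => innerC a (T x)) B := fun a =>
    ((hLs a).mul (hHs.inv fun x hx => hH0 x (hρW hx))).congr fun x hx => by
      have := hH0 x (hρW hx)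
      rw [Pi.inv_apply]
      field_simp
  have hTs : ContDiffOn ℝ ∞ T B := by
    set b := stdOrthonormalBasis ℝ E
    have h1 : ContDiffOn ℝ ∞ (fun x => ∑ i, (innerC (b i) (T x)).re • b i) B :=
      ContDiffOn.sum fun i _ => (Complex.reCLM.contDiff.comp_contDiffOn (hTL (b i))).smul
        contDiffOn_const
    refine h1.congr fun x _ => ?_
    simp only [innerC_apply, Complex.ofReal_re]
    exact (b.sum_repr' (T x)).symm
  have h2 : (2 : WithTop ℕ∞) ≤ ∞ := WithTop.coe_le_coe.2 le_top
  refine ⟨hHs.contDiffAt (hB.mem_nhds hyB), hTs.contDiffAt (hB.mem_nhds hyB),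
    laplacian_eqOn_of_weak hB (hHs.of_le h2) continuousOn_const (fun φ a1 a2 a3 => ?_) hyB,
    fun a => ⟨laplacian_eqOn_of_weak hB ((hLs a).of_le h2) continuousOn_const
      (fun φ a1 a2 a3 => ?_) hyB, laplacian_eqOn_of_weak hB (((hLs a).mul (hTL a)).of_le h2)
      (w := fun x => 2 * ((‖a‖ ^ 2 : ℝ) : ℂ) * H x) (continuousOn_const.mul hHB)
      (fun φ a1 a2 a3 => ?_) hyB⟩⟩
  · rw [hweakH φ a1 a2 a3]
    simp
  · rw [hweakL a φ a1 a2 a3]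
    simp
  · have := hint (fun x => innerC a x * innerC a x) ((innerC a).contDiff.mul (innerC a).contDiff)
      φ a1 a2 a3
    simp_rw [laplacian_innerC_sq] at this
    simp_rw [mul_assoc] at this ⊢
    rw [this]
    refine integral_congr_ae (Eventually.of_forall fun x => ?_)
    simp only
    ring

/-- A map intertwining the Laplacians is locally an isometry with locally constant weight. -/
theorem fderiv_eq_zero_of_intertwining [Nontrivial E] (hW : IsOpen W) (hWΩ : W ⊆ Ω₂)
    (hH : ContinuousOn H W) (hT : ContinuousOn T W) (hH0 : ∀ x ∈ W, H x ≠ 0)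
    (hmaps : MapsTo T W Ω₁)
    (hdistr : ∀ (f : 𝓓(Ω₁, ℂ)) (φ : 𝓓(Ω₂, ℂ)),
      ∫ x in (Ω₂ : Set E), H x * f (T x) * Laplacian.laplacian (φ : E → ℂ) x =
        ∫ x in (Ω₂ : Set E), H x * Laplacian.laplacian (f : E → ℂ) (T x) * φ x) :
    ContDiffOn ℝ ∞ H W ∧ ContDiffOn ℝ ∞ T W ∧
      (∀ y ∈ W, ∀ u, ‖fderiv ℝ T y u‖ = ‖u‖) ∧ (∀ y ∈ W, fderiv ℝ (fderiv ℝ T) y = 0) ∧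
      ∀ y ∈ W, fderiv ℝ H y = 0 := by
  have main := fun y (hy : y ∈ W) => exists_ball_laplacian_eq hW hWΩ hH hT hH0 hmaps hdistr hy
  have h2 : (2 : WithTop ℕ∞) ≤ ∞ := WithTop.coe_le_coe.2 le_top
  set b := stdOrthonormalBasis ℝ E
  have hHs : ContDiffOn ℝ ∞ H W := fun y hy => (main y hy).1.contDiffWithinAt
  have hTs : ContDiffOn ℝ ∞ T W := fun y hy => (main y hy).2.1.contDiffWithinAt
  have hTat : ∀ y ∈ W, ∀ a, ContDiffAt ℝ 2 (fun x => innerC a (T x)) y := fun y hy a =>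
    ((innerC a).contDiff.contDiffAt).comp y ((main y hy).2.1.of_le h2)
  have hfd : ∀ y ∈ W, ∀ a v, fderiv ℝ (fun x => innerC a (T x)) y v =
      innerC a (fderiv ℝ T y v) := by
    intro y hy a v
    have h1 := ((main y hy).2.1.differentiableAt (by simp)).hasFDerivAt
    exact congrArg (fun L => L v) ((innerC a).hasFDerivAt.comp y h1).fderiv
  -- Let `s = ⟨a, T⟩`. Expanding `Δ(H s) = 0` gives `H Δs + 2 ∇H·∇s = 0`, and expanding `Δ((H s) s)
  -- = 2|a|²H` gives the same expression times `s`, plus `2H|∇s|²`. Hence `|∇s|² = |a|²`, where `∇s`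
  -- is the adjoint of `DT` applied to `a`.
  have hadj : ∀ y ∈ W, ∀ a, ‖ContinuousLinearMap.adjoint (fderiv ℝ T y) a‖ = ‖a‖ := by
    intro y hy a
    obtain ⟨hHy, hTy, hlapH, hlap⟩ := main y hy
    obtain ⟨hl1, hl2⟩ := hlap a
    have hs := hTat y hy a
    have hHy2 := hHy.of_le h2
    have e1 := laplacian_mul b hHy2 hs
    rw [hl1, hlapH] at e1
    have e2 := laplacian_mul b (hHy2.mul hs) hs
    rw [hl1, hl2] at e2
    have hHd := (hHy2.differentiableAt (by simp)).hasFDerivAt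
    have hsd := (hs.differentiableAt (by simp)).hasFDerivAt
    have e3 : ∀ i, fderiv ℝ (fun x => H x * innerC a (T x)) y (b i) =
        H y * fderiv ℝ (fun x => innerC a (T x)) y (b i) + innerC a (T y) * fderiv ℝ H y (b i) := by
      intro i
      rw [(hHd.fun_mul hsd).fderiv]
      simp
    simp_rw [e3, add_mul, Finset.sum_add_distrib, mul_assoc, ← Finset.mul_sum] at e2
    have e4 : ∑ i, fderiv ℝ (fun x => innerC a (T x)) y (b i) *
        fderiv ℝ (fun x => innerC a (T x)) y (b i) = ((‖a‖ ^ 2 : ℝ) : ℂ) := by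
      refine mul_left_cancel₀ (mul_ne_zero two_ne_zero (hH0 y hy)) ?_
      linear_combination (-1 : ℂ) * e2 + innerC a (T y) * e1
    simp_rw [hfd y hy] at e4
    have e5 : ∀ v, innerC a (fderiv ℝ T y v) =
        innerC (ContinuousLinearMap.adjoint (fderiv ℝ T y) a) v := fun v => by
      rw [innerC_apply, innerC_apply, ContinuousLinearMap.adjoint_inner_left]
    simp_rw [e5] at e4
    rw [sum_innerC_sq b] at e4
    exact (pow_left_inj₀ (norm_nonneg _) (norm_nonneg _) two_ne_zero).1 (Complex.ofReal_inj.1 e4)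
  have hright : ∀ y ∈ W, fderiv ℝ T y ∘L ContinuousLinearMap.adjoint (fderiv ℝ T y) = 1 := by
    intro y hy
    have := (ContinuousLinearMap.norm_map_iff_adjoint_comp_self
      (ContinuousLinearMap.adjoint (fderiv ℝ T y))).1 (hadj y hy)
    rwa [ContinuousLinearMap.adjoint_adjoint] at this
  have hleft : ∀ y ∈ W, ContinuousLinearMap.adjoint (fderiv ℝ T y) ∘L fderiv ℝ T y = 1 := by
    intro y hy
    have h1 : (fderiv ℝ T y : E →ₗ[ℝ] E) *
        (ContinuousLinearMap.adjoint (fderiv ℝ T y) : E →ₗ[ℝ] E) = 1 := by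
      ext v
      exact congrArg (fun L : E →L[ℝ] E => L v) (hright y hy)
    have h3 := mul_eq_one_comm.1 h1
    ext v
    exact congrArg (fun L : E →ₗ[ℝ] E => L v) h3
  have hiso : ∀ y ∈ W, ∀ u, ‖fderiv ℝ T y u‖ = ‖u‖ := fun y hy =>
    (ContinuousLinearMap.norm_map_iff_adjoint_comp_self (fderiv ℝ T y)).2 (hleft y hy)
  have hsecond : ∀ y ∈ W, fderiv ℝ (fderiv ℝ T) y = 0 := fun y hy =>
    fderiv_fderiv_eq_zero_of_isometric hW (hTs.of_le h2) hiso hy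
  refine ⟨hHs, hTs, hiso, hsecond, fun y hy => ?_⟩
  obtain ⟨hHy, hTy, hlapH, hlap⟩ := main y hy
  -- Since `D²T = 0`, the components of `T` are harmonic, and `Δ(H s) = 0` reduces to `∇H·∇s = 0`.
  -- The adjoint of `DT` is onto, so this covers every direction.
  have hzero : ∀ a, fderiv ℝ H y (ContinuousLinearMap.adjoint (fderiv ℝ T y) a) = 0 := by
    intro a
    have hs := hTat y hy a
    have e1 := laplacian_mul b (hHy.of_le h2) hs
    have e2 : Laplacian.laplacian (fun x => innerC a (T x)) y = 0 := by
      have := (hTy.of_le h2).laplacian_CLM_comp_left (l := innerC a)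
      refine this.trans ?_
      rw [Function.comp_apply, laplacian_eq_sum_fderiv b, hsecond y hy]
      simp
    rw [(hlap a).1, hlapH, e2] at e1
    simp_rw [hfd y hy] at e1
    set c := ContinuousLinearMap.adjoint (fderiv ℝ T y) a with hc
    have e5 : ∀ v, innerC a (fderiv ℝ T y v) = innerC c v := fun v => by
      rw [innerC_apply, innerC_apply, hc, ContinuousLinearMap.adjoint_inner_left]
    simp_rw [e5] at e1
    have e6 : fderiv ℝ H y c = ∑ i, fderiv ℝ H y (b i) * innerC c (b i) := by
      conv_lhs => rw [← b.sum_repr' c]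
      rw [map_sum]
      refine Finset.sum_congr rfl fun i _ => ?_
      rw [map_smul, innerC_apply, real_inner_comm, Complex.real_smul, mul_comm]
    rw [e6]
    simpa using e1
  ext v
  have := hzero (fderiv ℝ T y v)
  have e : ContinuousLinearMap.adjoint (fderiv ℝ T y) (fderiv ℝ T y v) = v :=
    congrArg (fun L : E →L[ℝ] E => L v) (hleft y hy)
  rw [e] at this
  simpa using this

end LocalStructure

/-! ### `U` as a weighted composition operator. -/

section Symbol

variable {d : ℕ}

theorem zeroExt_apply {s : Set (EuclideanSpace ℝ (Fin d))} (u : C(s, ℂ))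
    {y : EuclideanSpace ℝ (Fin d)} (hy : y ∈ s) : zeroExt u y = u ⟨y, hy⟩ :=
  Subtype.val_injective.extend_apply u 0 ⟨y, hy⟩

theorem zeroExt_of_notMem {s : Set (EuclideanSpace ℝ (Fin d))} (u : C(s, ℂ))
    {y : EuclideanSpace ℝ (Fin d)} (hy : y ∉ s) : zeroExt u y = 0 :=
  Function.extend_apply' _ _ _ fun ⟨a, ha⟩ => hy (ha ▸ a.2)

theorem continuousOn_zeroExt {s : Set (EuclideanSpace ℝ (Fin d))} (u : C(s, ℂ)) :
    ContinuousOn (zeroExt u) s := by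
  rw [continuousOn_iff_continuous_domRestrict]
  convert u.continuous using 1
  funext y
  exact zeroExt_apply u y.2

variable {Ω₁ Ω₂ : Opens (EuclideanSpace ℝ (Fin d))}

/-- The `i`-th coordinate function. -/
def coordFun (Ω : Opens (EuclideanSpace ℝ (Fin d))) (i : Fin d) :
    C(closure (Ω : Set (EuclideanSpace ℝ (Fin d))), ℂ) :=
  ⟨fun x => ((x : EuclideanSpace ℝ (Fin d)) i : ℂ), by fun_prop⟩

variable (U : C(closure (Ω₁ : Set (EuclideanSpace ℝ (Fin d))), ℂ) →L[ℂ]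
      C(closure (Ω₂ : Set (EuclideanSpace ℝ (Fin d))), ℂ))

/-- The weight `h` of the weighted composition operator `U f = h · (f ∘ τ)`. -/
def weight : EuclideanSpace ℝ (Fin d) → ℂ := zeroExt (U 1)

/-- The map `τ` of the weighted composition operator `U f = h · (f ∘ τ)`. -/
def symbol (y : EuclideanSpace ℝ (Fin d)) : EuclideanSpace ℝ (Fin d) :=
  WithLp.toLp 2 fun i => (zeroExt (U (coordFun Ω₁ i)) y / weight U y).re

variable {U}

theorem continuousOn_weight :
    ContinuousOn (weight U) (closure (Ω₂ : Set (EuclideanSpace ℝ (Fin d)))) :=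
  continuousOn_zeroExt _

theorem continuousOn_symbol :
    ContinuousOn (symbol U) {y ∈ closure (Ω₂ : Set (EuclideanSpace ℝ (Fin d))) | weight U y ≠ 0} := by
  refine (PiLp.continuous_toLp 2 _).comp_continuousOn (continuousOn_pi.2 fun i => ?_)
  exact Complex.continuous_re.comp_continuousOn
    (((continuousOn_zeroExt _).mono fun y hy => hy.1).div
      (continuousOn_weight.mono fun y hy => hy.1) fun y hy => hy.2)

theorem exists_apply_eq_weight_mul
    (hbdd₁ : Bornology.IsBounded (Ω₁ : Set (EuclideanSpace ℝ (Fin d))))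
    (hne₁ : (Ω₁ : Set (EuclideanSpace ℝ (Fin d))).Nonempty)
    (ha : ∀ f g : C(closure (Ω₁ : Set (EuclideanSpace ℝ (Fin d))), ℂ), f * g = 0 → U f * U g = 0)
    (y : closure (Ω₂ : Set (EuclideanSpace ℝ (Fin d)))) :
    ∃ x, ∀ f, U f y = weight U y * f x := by
  have : CompactSpace (closure (Ω₁ : Set (EuclideanSpace ℝ (Fin d)))) :=
    isCompact_iff_compactSpace.1 hbdd₁.isCompact_closure
  have : Nonempty (closure (Ω₁ : Set (EuclideanSpace ℝ (Fin d)))) := hne₁.closure.to_subtype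
  have hcont : Continuous fun f => U f y := by fun_prop
  let Λ : C(closure (Ω₁ : Set (EuclideanSpace ℝ (Fin d))), ℂ) →L[ℂ] ℂ :=
    { toFun := fun f => U f y
      map_add' := fun f g => by simp
      map_smul' := fun c f => by simp
      cont := hcont }
  obtain ⟨x, hx⟩ := exists_eq_mul_eval Λ fun f g hfg =>
    congrArg (fun u => u y) (ha f g hfg)
  refine ⟨x, fun f => ?_⟩
  rw [weight, zeroExt_apply _ y.2]
  exact hx f

theorem exists_apply_eq_symbol
    (hbdd₁ : Bornology.IsBounded (Ω₁ : Set (EuclideanSpace ℝ (Fin d))))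
    (hne₁ : (Ω₁ : Set (EuclideanSpace ℝ (Fin d))).Nonempty)
    (ha : ∀ f g : C(closure (Ω₁ : Set (EuclideanSpace ℝ (Fin d))), ℂ), f * g = 0 → U f * U g = 0)
    (y : closure (Ω₂ : Set (EuclideanSpace ℝ (Fin d))))
    (hy : weight U y ≠ 0) :
    ∃ hT : symbol U y ∈ closure (Ω₁ : Set (EuclideanSpace ℝ (Fin d))),
      ∀ f, U f y = weight U y * f ⟨symbol U y, hT⟩ := by
  obtain ⟨x, hx⟩ := exists_apply_eq_weight_mul hbdd₁ hne₁ ha y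
  have : symbol U y = x := by
    ext i
    change (zeroExt (U (coordFun Ω₁ i)) y / weight U y).re = _
    rw [zeroExt_apply _ y.2, hx, mul_div_cancel_left₀ _ hy]
    exact Complex.ofReal_re _
  exact ⟨this ▸ x.2, fun f => by rw [hx f]; congr 2; exact Subtype.ext this.symm⟩

/-- Here `F` is any extension of `f`. The formula needs no side condition: where the weight
vanishes, in particular off `closure Ω₂`, both sides are zero whatever `symbol` returns. -/
theorem zeroExt_apply_eq
    (hbdd₁ : Bornology.IsBounded (Ω₁ : Set (EuclideanSpace ℝ (Fin d))))
    (hne₁ : (Ω₁ : Set (EuclideanSpace ℝ (Fin d))).Nonempty)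
    (ha : ∀ f g : C(closure (Ω₁ : Set (EuclideanSpace ℝ (Fin d))), ℂ), f * g = 0 → U f * U g = 0)
    (f : C(closure (Ω₁ : Set (EuclideanSpace ℝ (Fin d))), ℂ))
    {F : EuclideanSpace ℝ (Fin d) → ℂ} (hF : ∀ x, f x = F x) :
    zeroExt (U f) = fun y => weight U y * F (symbol U y) := by
  funext y
  by_cases hy : y ∈ closure (Ω₂ : Set (EuclideanSpace ℝ (Fin d)))
  · rw [zeroExt_apply _ hy]
    by_cases hw : weight U y = 0
    · obtain ⟨x, hx⟩ := exists_apply_eq_weight_mul hbdd₁ hne₁ ha ⟨y, hy⟩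
      rw [hx]
      simp only [hw, zero_mul]
    · obtain ⟨hT, h⟩ := exists_apply_eq_symbol hbdd₁ hne₁ ha ⟨y, hy⟩ hw
      rw [h, hF]
  · rw [zeroExt_of_notMem _ hy, weight, zeroExt_of_notMem _ hy, zero_mul]

end Symbol

/-! ### From isometric differentials to a rigid motion on a connected set. -/

section Components

variable {E : Type*} [NormedAddCommGroup E] [InnerProductSpace ℝ E] [FiniteDimensional ℝ E]

/-- A map with isometric differentials and vanishing second derivative on a connected open set is
the restriction of a rigid motion. -/
theorem exists_linearIsometryEquiv_eqOn {D : Set E} (hD : IsOpen D) (hDc : IsPreconnected D)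
    (hne : D.Nonempty) {T : E → E} (hT : ContDiffOn ℝ ∞ T D)
    (hiso : ∀ y ∈ D, ∀ u, ‖fderiv ℝ T y u‖ = ‖u‖)
    (hsec : ∀ y ∈ D, fderiv ℝ (fderiv ℝ T) y = 0) :
    ∃ (L : E ≃ₗᵢ[ℝ] E) (b : E), ∀ y ∈ D, T y = L y + b := by
  obtain ⟨y₀, hy₀⟩ := hne
  have h1 : DifferentiableOn ℝ (fderiv ℝ T) D :=
    (hT.fderiv_of_isOpen hD (m := 1) (WithTop.coe_le_coe.2 le_top)).differentiableOn (by simp)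
  have hconst : ∀ y ∈ D, fderiv ℝ T y = fderiv ℝ T y₀ := fun y hy =>
    hD.is_const_of_fderiv_eq_zero hDc h1 hsec hy hy₀
  let l : E →ₗᵢ[ℝ] E := ⟨(fderiv ℝ T y₀ : E →ₗ[ℝ] E), hiso y₀ hy₀⟩
  let L : E ≃ₗᵢ[ℝ] E := l.toLinearIsometryEquiv rfl
  have hL : ∀ v, L v = fderiv ℝ T y₀ v := fun v => rfl
  have hTd : DifferentiableOn ℝ T D := hT.differentiableOn (by simp)
  have h2 : DifferentiableOn ℝ (fun y => T y - fderiv ℝ T y₀ y) D :=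
    hTd.sub (fderiv ℝ T y₀).differentiable.differentiableOn
  have h3 : EqOn (fderiv ℝ fun y => T y - fderiv ℝ T y₀ y) 0 D := by
    intro y hy
    rw [fderiv_fun_sub (hTd.differentiableAt (hD.mem_nhds hy)) (fderiv ℝ T y₀).differentiableAt,
      ContinuousLinearMap.fderiv, hconst y hy, sub_self]
    rfl
  refine ⟨L, T y₀ - fderiv ℝ T y₀ y₀, fun y hy => ?_⟩
  have := hD.is_const_of_fderiv_eq_zero hDc h2 h3 hy hy₀
  rw [hL, ← this]
  abel

end Components

/-! ### The Robin condition near a boundary point where the operator is a rigid motion. -/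

section Robin

/-- Almost everywhere counterpart of `eqOn_of_integral_mul_eq`, needed because the weak gradient and
Laplacian in `HasNormalDeriv` are only square integrable. -/
theorem ae_eq_of_integral_mul_eq {E : Type*} [NormedAddCommGroup E] [NormedSpace ℝ E]
    [FiniteDimensional ℝ E] [MeasurableSpace E] [BorelSpace E] {μ : Measure E}
    {f g : E → ℂ} {s : Set E} (hs : IsOpen s)
    (hf : IntegrableOn f s μ) (hg : IntegrableOn g s μ)
    (h : ∀ φ : E → ℂ, ContDiff ℝ ∞ φ → HasCompactSupport φ → tsupport φ ⊆ s →
      ∫ x, f x * φ x ∂μ = ∫ x, g x * φ x ∂μ) : ∀ᵐ x ∂μ, x ∈ s → f x = g x := by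
  have hint : ∀ k : E → ℂ, IntegrableOn k s μ → ∀ φ : E → ℂ, ContDiff ℝ ∞ φ →
      HasCompactSupport φ → tsupport φ ⊆ s → Integrable (fun x => k x * φ x) μ := by
    intro k hk φ hφ hc hsub
    obtain ⟨C, hC⟩ := hφ.continuous.bounded_above_of_compact_support hc
    rw [← integrableOn_iff_integrable_of_support_subset (s := s)]
    · exact Integrable.mul_bdd hk hφ.continuous.aestronglyMeasurable
        (Eventually.of_forall hC)
    · exact fun x hx => hsub (subset_tsupport φ (right_ne_zero_of_mul hx))
  have h1 := hs.ae_eq_zero_of_integral_contDiff_smul_eq_zero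
    (f := fun x => f x - g x) (μ := μ) (IntegrableOn.locallyIntegrableOn (hf.sub hg)) ?_
  · filter_upwards [h1] with x hx hxs using sub_eq_zero.1 (hx hxs)
  · intro φ hφ hc hsub
    have hsupp : tsupport (fun x => (φ x : ℂ)) ⊆ s := by
      refine subset_trans (closure_mono fun x hx => ?_) hsub
      simpa using hx
    have hφc : ContDiff ℝ ∞ fun x => (φ x : ℂ) := Complex.ofRealCLM.contDiff.comp hφ
    have hcc : HasCompactSupport fun x => (φ x : ℂ) := hc.comp_left Complex.ofReal_zero
    have := h _ hφc hcc hsupp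
    rw [← sub_eq_zero, ← integral_sub (hint f hf _ hφc hcc hsupp)
      (hint g hg _ hφc hcc hsupp)] at this
    rw [← this]
    refine integral_congr_ae (Eventually.of_forall fun x => ?_)
    simp only [Complex.real_smul]
    ring

variable {d : ℕ} {Ω Ω₁ Ω₂ : Opens (EuclideanSpace ℝ (Fin d))}

theorem partialDeriv_of_eventuallyEq {i : Fin d} {f g : EuclideanSpace ℝ (Fin d) → ℂ}
    {x : EuclideanSpace ℝ (Fin d)} (h : f =ᶠ[𝓝 x] g) :
    partialDeriv i f x = partialDeriv i g x := by
  rw [partialDeriv, partialDeriv, h.fderiv_eq]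

theorem continuous_partialDeriv {f : EuclideanSpace ℝ (Fin d) → ℂ} (hf : ContDiff ℝ ∞ f)
    (i : Fin d) : Continuous (partialDeriv i f) :=
  (hf.continuous_fderiv (by simp)).clm_apply continuous_const

/-- Test functions on `ℝ^d` belong to `H^1(Ω)`. -/
theorem isH1_of_contDiff {v : EuclideanSpace ℝ (Fin d) → ℂ} (hv : ContDiff ℝ ∞ v)
    (hc : HasCompactSupport v) : IsH1 Ω v fun i => partialDeriv i v where
  memL2 := hv.continuous.memLp_of_hasCompactSupport hc
  memL2_grad i := (continuous_partialDeriv hv i).memLp_of_hasCompactSupport (hc.fderiv_apply ℝ _)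
  isWeakGradient i φ := by
    have hφ0 : ∀ x ∉ (Ω : Set (EuclideanSpace ℝ (Fin d))), φ =ᶠ[𝓝 x] fun _ => 0 := fun x hx =>
      notMem_tsupport_iff_eventuallyEq.1 fun h' => hx (φ.tsupport_subset h')
    rw [setIntegral_eq_integral_of_forall_compl_eq_zero,
      setIntegral_eq_integral_of_forall_compl_eq_zero]
    · exact integral_mul_fderiv_of_contDiffOn isOpen_univ (hv.of_le (by simp)).contDiffOn
        (φ.contDiff.of_le (by simp)) φ.hasCompactSupport (subset_univ _) _
    · intro x hx
      rw [(hφ0 x hx).eq_of_nhds, mul_zero]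
    · intro x hx
      rw [partialDeriv_of_eventuallyEq (hφ0 x hx)]
      simp [partialDeriv]

/-- A test function is its own trace on a Lipschitz boundary. -/
theorem isTrace_of_contDiff (hΩ : IsLipschitzDomain Ω) {v : EuclideanSpace ℝ (Fin d) → ℂ}
    (hv : ContDiff ℝ ∞ v) (hc : HasCompactSupport v) :
    IsTrace Ω v (fun i => partialDeriv i v) v := by
  -- Local finiteness puts `v` in `L²(∂Ω)`; the constant sequence `v` then serves as the
  -- approximation.
  have := hΩ.isLocallyFiniteMeasure
  exact ⟨hv.continuous.memLp_of_hasCompactSupport hc, fun _ => v, fun _ => hv, by simp, by simp,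
    by simp⟩

/-- If `u` coincides with a multiple of a harmonic function `q` near a point, the Robin boundary
condition for `u` is inherited by `q`. -/
theorem HasNormalDeriv.integral_eq_of_eqOn (hΩ : IsLipschitzDomain Ω)
    (hbdd : Bornology.IsBounded (Ω : Set (EuclideanSpace ℝ (Fin d))))
    {u β q : EuclideanSpace ℝ (Fin d) → ℂ} {c : ℂ} (hc0 : c ≠ 0)
    {N : Set (EuclideanSpace ℝ (Fin d))} (hN : IsOpen N)
    (hu : HasNormalDeriv Ω u fun x => -(β x * u x)) (hq : ContDiff ℝ ∞ q)
    (hqL : ∀ x, Laplacian.laplacian q x = 0)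
    (huq : ∀ x ∈ N ∩ closure (Ω : Set (EuclideanSpace ℝ (Fin d))), u x = c * q x)
    {v : EuclideanSpace ℝ (Fin d) → ℂ} (hv : ContDiff ℝ ∞ v) (hvc : HasCompactSupport v)
    (hvN : tsupport v ⊆ N) :
    ∫ x in (Ω : Set (EuclideanSpace ℝ (Fin d))),
      ∑ i, partialDeriv i q x * (starRingEnd ℂ) (partialDeriv i v x) =
    -∫ x, β x * q x * (starRingEnd ℂ) (v x) ∂(surfaceMeasure Ω) := by
  obtain ⟨G, w, hG, hw, hlap, -, hgreen⟩ := hu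
  set s : Set (EuclideanSpace ℝ (Fin d)) := Ω ∩ N with hs_def
  have hs : IsOpen s := Ω.isOpen.inter hN
  have hfin : IsFiniteMeasure (volume.restrict (Ω : Set (EuclideanSpace ℝ (Fin d)))) :=
    isFiniteMeasure_restrict.2 hbdd.measure_lt_top.ne
  have hL2 : ∀ g, MemL2 Ω g → IntegrableOn g s := fun g hg =>
    IntegrableOn.mono_set (MemLp.integrable one_le_two hg) inter_subset_left
  have hcont : ∀ g : EuclideanSpace ℝ (Fin d) → ℂ, Continuous g → IntegrableOn g s := fun g hg =>
    (hg.continuousOn.integrableOn_compact hbdd.isCompact_closure).mono_set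
      (inter_subset_left.trans subset_closure)
  have huqs : ∀ x ∈ s, u x = c * q x := fun x hx => huq x ⟨hx.2, subset_closure hx.1⟩
  have hcq : ContDiff ℝ ∞ fun x => c * q x := contDiff_const.mul hq
  have hzero : ∀ φ : EuclideanSpace ℝ (Fin d) → ℂ, tsupport φ ⊆ s → ∀ x ∉ s,
      φ =ᶠ[𝓝 x] fun _ => 0 := fun φ hφ x hx =>
    notMem_tsupport_iff_eventuallyEq.1 fun h' => hx (hφ h')
  -- `HasNormalDeriv` supplies some gradient `G` and Laplacian `w`. On `Ω ∩ N` they must coincide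
  -- almost everywhere with those of `c q`, namely `c ∇q` and `0`; then Green's formula for `u`
  -- becomes `c` times the one for `q`.
  have hGae : ∀ i, ∀ᵐ x, x ∈ s → G i x = c * partialDeriv i q x := by
    intro i
    refine ae_eq_of_integral_mul_eq hs (hL2 _ (hG.memL2_grad i))
      (hcont _ (continuous_const.mul (continuous_partialDeriv hq i))) fun φ h1 h2 h3 => ?_
    have key := hG.isWeakGradient i ⟨φ, h1, h2, h3.trans inter_subset_left⟩
    change ∫ x in (Ω : Set (EuclideanSpace ℝ (Fin d))), u x * partialDeriv i φ x =
      -∫ x in (Ω : Set (EuclideanSpace ℝ (Fin d))), G i x * φ x at key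
    rw [setIntegral_eq_integral_of_forall_compl_eq_zero,
      setIntegral_eq_integral_of_forall_compl_eq_zero] at key
    · have e1 : ∫ x, u x * partialDeriv i φ x = ∫ x, (c * q x) * partialDeriv i φ x := by
        refine integral_congr_ae (Eventually.of_forall fun x => ?_)
        by_cases hx : x ∈ s
        · simp only [huqs x hx]
        · simp only [partialDeriv_of_eventuallyEq (hzero φ h3 x hx)]
          simp [partialDeriv]
      have e2 := integral_mul_fderiv_of_contDiffOn isOpen_univ (hcq.of_le (by simp)).contDiffOn
        (h1.of_le (by simp)) h2 (subset_univ _) (EuclideanSpace.single i 1)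
      have e3 : ∀ x, fderiv ℝ (fun x => c * q x) x (EuclideanSpace.single i 1) =
          c * partialDeriv i q x := fun x => by
        rw [fderiv_const_mul (hq.differentiable (by simp) x)]
        rfl
      simp_rw [e3] at e2
      rw [e1] at key
      exact (neg_injective (e2.symm.trans key)).symm
    · exact fun x hx => by
        rw [(hzero φ h3 x fun h' => hx h'.1).eq_of_nhds, mul_zero]
    · intro x hx
      rw [partialDeriv_of_eventuallyEq (hzero φ h3 x fun h' => hx h'.1)]
      simp [partialDeriv]
  have hwae : ∀ᵐ x, x ∈ s → w x = 0 := by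
    refine ae_eq_of_integral_mul_eq hs (hL2 _ hw) (hcont _ continuous_const) fun φ h1 h2 h3 => ?_
    have key := hlap ⟨φ, h1, h2, h3.trans inter_subset_left⟩
    change ∫ x in (Ω : Set (EuclideanSpace ℝ (Fin d))), u x * Laplacian.laplacian φ x =
      ∫ x in (Ω : Set (EuclideanSpace ℝ (Fin d))), w x * φ x at key
    rw [setIntegral_eq_integral_of_forall_compl_eq_zero,
      setIntegral_eq_integral_of_forall_compl_eq_zero] at key
    · have e1 : ∫ x, u x * Laplacian.laplacian φ x = ∫ x, (c * q x) * Laplacian.laplacian φ x := by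
        refine integral_congr_ae (Eventually.of_forall fun x => ?_)
        by_cases hx : x ∈ s
        · simp only [huqs x hx]
        · simp [(InnerProductSpace.laplacian_congr_nhds (hzero φ h3 x hx)).eq_of_nhds]
      have h2' : (2 : WithTop ℕ∞) ≤ ∞ := WithTop.coe_le_coe.2 le_top
      have e2 := integral_mul_laplacian isOpen_univ (hq.of_le h2').contDiffOn
        (h1.of_le h2') h2 (subset_univ _)
      simp_rw [hqL, zero_mul, integral_zero] at e2
      simp_rw [e1, mul_assoc] at key
      rw [integral_const_mul, e2, mul_zero] at key
      rw [← key]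
      simp
    · exact fun x hx => by
        rw [(hzero φ h3 x fun h' => hx h'.1).eq_of_nhds, mul_zero]
    · intro x hx
      simp [(InnerProductSpace.laplacian_congr_nhds
        (hzero φ h3 x fun h' => hx h'.1)).eq_of_nhds]
  have hv0 : ∀ x ∉ N, v =ᶠ[𝓝 x] fun _ => 0 := fun x hx =>
    notMem_tsupport_iff_eventuallyEq.1 fun h' => hx (hvN h')
  have key := hgreen v _ v (isH1_of_contDiff hv hvc) (isTrace_of_contDiff hΩ hv hvc)
  have e1 : ∫ x in (Ω : Set (EuclideanSpace ℝ (Fin d))),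
      ((∑ i, G i x * (starRingEnd ℂ) (partialDeriv i v x)) + w x * (starRingEnd ℂ) (v x)) =
      ∫ x in (Ω : Set (EuclideanSpace ℝ (Fin d))),
        c * ∑ i, partialDeriv i q x * (starRingEnd ℂ) (partialDeriv i v x) := by
    refine setIntegral_congr_ae Ω.isOpen.measurableSet ?_
    filter_upwards [ae_all_iff.2 hGae, hwae] with x hx hx' hxΩ
    by_cases hxN : x ∈ N
    · rw [hx' ⟨hxΩ, hxN⟩, zero_mul, add_zero, Finset.mul_sum]
      exact Finset.sum_congr rfl fun i _ => by rw [hx i ⟨hxΩ, hxN⟩, mul_assoc]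
    · simp_rw [partialDeriv_of_eventuallyEq (hv0 x hxN), (hv0 x hxN).eq_of_nhds]
      simp [partialDeriv]
  have e2 : ∫ x, -(β x * u x) * (starRingEnd ℂ) (v x) ∂(surfaceMeasure Ω) =
      ∫ x, -c * (β x * q x * (starRingEnd ℂ) (v x)) ∂(surfaceMeasure Ω) := by
    refine setIntegral_congr_fun isClosed_frontier.measurableSet fun x hx => ?_
    by_cases hxN : x ∈ N
    · simp only [huq x ⟨hxN, hx.1⟩]
      ring
    · simp [(hv0 x hxN).eq_of_nhds]
  rw [e1, e2, integral_const_mul, integral_const_mul, neg_mul, ← mul_neg] at key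
  exact mul_left_cancel₀ hc0 key

/-- The Robin condition cannot hold near a Lipschitz boundary point for both the constant functions
and all linear functions. -/
theorem IsLipschitzDomain.false_of_integral_eq (hΩ : IsLipschitzDomain Ω)
    {z : EuclideanSpace ℝ (Fin d)} (hz : z ∈ frontier (Ω : Set (EuclideanSpace ℝ (Fin d))))
    {R : ℝ} (hR : 0 < R) {β : EuclideanSpace ℝ (Fin d) → ℂ}
    (h : ∀ q : EuclideanSpace ℝ (Fin d) → ℂ, ContDiff ℝ ∞ q →
      (∀ x, Laplacian.laplacian q x = 0) → ∀ v : EuclideanSpace ℝ (Fin d) → ℂ, ContDiff ℝ ∞ v →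
      HasCompactSupport v → tsupport v ⊆ Metric.ball z R →
      ∫ x in (Ω : Set (EuclideanSpace ℝ (Fin d))),
        ∑ i, partialDeriv i q x * (starRingEnd ℂ) (partialDeriv i v x) =
      -∫ x, β x * q x * (starRingEnd ℂ) (v x) ∂(surfaceMeasure Ω)) : False := by
  obtain ⟨e, he⟩ := hΩ.exists_not_integral_fderiv_eq_zero hz hR
  refine he fun v hv hvc hvR => ?_
  -- Pairing `q = 1` with `⟨e, x⟩v` and `q = ⟨e, x⟩` with `v` gives the same boundary integral, as
  -- `⟨e, x⟩` is real. The first volume integral is zero, so the second, the conjugate of `∫_Ω ∂_e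
  -- v`, vanishes too.
  have h1 := h (fun _ => 1) contDiff_const (fun x => by simp) (fun x => innerC e x * v x)
    ((innerC e).contDiff.mul hv) hvc.mul_left
    ((closure_mono fun x hx => right_ne_zero_of_mul hx).trans hvR)
  have h2 := h (fun x => innerC e x) (innerC e).contDiff (laplacian_innerC e) v hv hvc hvR
  have e1 : ∀ x, β x * innerC e x * (starRingEnd ℂ) (v x) =
      β x * 1 * (starRingEnd ℂ) (innerC e x * v x) := fun x => by
    rw [map_mul, innerC_apply, Complex.conj_ofReal]
    ring
  simp_rw [e1] at h2
  rw [← h1] at h2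
  have e2 : ∀ x, ∑ i, partialDeriv i (fun x => innerC e x) x *
      (starRingEnd ℂ) (partialDeriv i v x) = (starRingEnd ℂ) (fderiv ℝ v x e) := by
    intro x
    have e3 : fderiv ℝ v x e = ∑ i, ((e i : ℝ) : ℂ) * partialDeriv i v x := by
      conv_lhs => rw [← (EuclideanSpace.basisFun (Fin d) ℝ).sum_repr e]
      rw [map_sum]
      refine Finset.sum_congr rfl fun i _ => ?_
      rw [map_smul, Complex.real_smul]
      simp [partialDeriv]
    rw [e3, map_sum]
    refine Finset.sum_congr rfl fun i _ => ?_
    rw [map_mul, Complex.conj_ofReal, partialDeriv, ContinuousLinearMap.fderiv, innerC_apply]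
    simp [EuclideanSpace.inner_single_right]
  simp_rw [e2] at h2
  rw [integral_conj] at h2
  have e4 : ∀ (i : Fin d) (x : EuclideanSpace ℝ (Fin d)),
    partialDeriv i (fun _ : EuclideanSpace ℝ (Fin d) => (1 : ℂ)) x = 0 := fun i x => by
      simp [partialDeriv]
  simp_rw [e4, zero_mul, Finset.sum_const_zero, integral_zero] at h2
  simpa using h2

end Robin

/-! ### Each component of the active set is mapped onto `Ω₁`. -/

section RigidComponents

variable {d : ℕ} {Ω₁ Ω₂ : Opens (EuclideanSpace ℝ (Fin d))}
  {H β : EuclideanSpace ℝ (Fin d) → ℂ} {T : EuclideanSpace ℝ (Fin d) → EuclideanSpace ℝ (Fin d)}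

/-- If a weighted rigid motion maps test functions on `Ω₁` to functions satisfying the Robin
boundary condition near a boundary point of `Ω₂`, then it maps that point outside `Ω₁`. -/
theorem rigidMotion_notMem_of_mem_frontier (hlip₂ : IsLipschitzDomain Ω₂)
    (hbdd₂ : Bornology.IsBounded (Ω₂ : Set (EuclideanSpace ℝ (Fin d))))
    (hrobin : ∀ f : 𝓓(Ω₁, ℂ), HasNormalDeriv Ω₂ (fun y => H y * f (T y))
      fun y => -(β y * (H y * f (T y))))
    {z : EuclideanSpace ℝ (Fin d)} (hz : z ∈ frontier (Ω₂ : Set (EuclideanSpace ℝ (Fin d))))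
    {L : EuclideanSpace ℝ (Fin d) ≃ₗᵢ[ℝ] EuclideanSpace ℝ (Fin d)} {b : EuclideanSpace ℝ (Fin d)}
    {c : ℂ} (hc : c ≠ 0) {R : ℝ} (hR : 0 < R)
    (hHT : ∀ x ∈ Metric.ball z R ∩ closure (Ω₂ : Set (EuclideanSpace ℝ (Fin d))),
      H x = c ∧ T x = L x + b) : L z + b ∉ Ω₁ := by
  intro hzΩ
  obtain ⟨η, hη, hηΩ⟩ := Metric.nhds_basis_closedBall.mem_iff.1 (Ω₁.isOpen.mem_nhds hzΩ)
  let χ : ContDiffBump (L z + b) := ⟨η / 2, η, by positivity, by linarith⟩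
  -- The motion is an isometry, so points within `η / 2` of `z` land where `χ = 1`. Pulling `q` back
  -- by the inverse motion and cutting off yields a test function sent to `c q` near `z`.
  refine hlip₂.false_of_integral_eq hz (R := min R (η / 2)) (by positivity) (β := β)
    fun q hq hqL v hv hvc hvR => ?_
  set p : EuclideanSpace ℝ (Fin d) → ℂ := fun x => q (L.symm (x - b)) with hp
  have hpd : ContDiff ℝ ∞ p :=
    hq.comp (L.symm.contDiff.comp (contDiff_id.sub contDiff_const))
  have hts : tsupport (fun x => ((χ x : ℝ) : ℂ) * p x) ⊆ Metric.closedBall (L z + b) η := by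
    refine closure_minimal (fun x hx => ?_) Metric.isClosed_closedBall
    have h1 : χ x ≠ 0 := fun h0 => hx (by simp [h0])
    have h2 : x ∈ Function.support χ := h1
    rw [χ.support_eq] at h2
    exact Metric.ball_subset_closedBall h2
  let f : 𝓓(Ω₁, ℂ) := ⟨fun x => ((χ x : ℝ) : ℂ) * p x,
    (Complex.ofRealCLM.contDiff.comp χ.contDiff).mul hpd,
    HasCompactSupport.of_support_subset_isCompact (isCompact_closedBall (L z + b) η)
      (subset_closure.trans hts), hts.trans hηΩ⟩
  refine (hrobin f).integral_eq_of_eqOn hlip₂ hbdd₂ hc Metric.isOpen_ball hq hqL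
    (fun x hx => ?_) hv hvc hvR
  obtain ⟨h1, h2⟩ := hHT x ⟨Metric.ball_subset_ball (min_le_left _ _) hx.1, hx.2⟩
  have h3 : L x + b ∈ Metric.closedBall (L z + b) (η / 2) := by
    rw [Metric.mem_closedBall, dist_add_right, L.dist_map]
    exact (Metric.mem_ball.1 hx.1).le.trans (min_le_right _ _)
  have h4 : χ (L x + b) = 1 := χ.one_of_mem_closedBall h3
  change H x * (((χ (T x) : ℝ) : ℂ) * q (L.symm (T x - b))) = c * q x
  rw [h1, h2, h4, add_sub_cancel_right, L.symm_apply_apply, Complex.ofReal_one, one_mul]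

/-- The open subset of `Ω₂` on which a weighted composition operator sees test functions
on `Ω₁`. -/
def activeSet (Ω₁ Ω₂ : Opens (EuclideanSpace ℝ (Fin d))) (H : EuclideanSpace ℝ (Fin d) → ℂ)
    (T : EuclideanSpace ℝ (Fin d) → EuclideanSpace ℝ (Fin d)) : Set (EuclideanSpace ℝ (Fin d)) :=
  {y | y ∈ Ω₂ ∧ H y ≠ 0 ∧ T y ∈ Ω₁}

/-- Applies also at boundary points of `Ω₂`, where `H` and `T` are continuous only relative to the
closure. -/
theorem exists_ball_inter_subset
    (hH : ContinuousOn H (closure (Ω₂ : Set (EuclideanSpace ℝ (Fin d)))))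
    (hT : ContinuousOn T {y ∈ closure (Ω₂ : Set (EuclideanSpace ℝ (Fin d))) | H y ≠ 0})
    {y : EuclideanSpace ℝ (Fin d)} (hy : y ∈ closure (Ω₂ : Set (EuclideanSpace ℝ (Fin d))))
    (hHy : H y ≠ 0) (hTy : T y ∈ Ω₁) :
    ∃ R > 0, ∀ x ∈ Metric.ball y R ∩ closure (Ω₂ : Set (EuclideanSpace ℝ (Fin d))),
      H x ≠ 0 ∧ T x ∈ Ω₁ := by
  have h1 : ∀ᶠ x in 𝓝[closure (Ω₂ : Set (EuclideanSpace ℝ (Fin d)))] y, H x ≠ 0 :=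
    (hH y hy).eventually_ne hHy
  have h2 : ∀ᶠ x in 𝓝[{y ∈ closure (Ω₂ : Set (EuclideanSpace ℝ (Fin d))) | H y ≠ 0}] y,
      T x ∈ Ω₁ := hT y ⟨hy, hHy⟩ (Ω₁.isOpen.mem_nhds hTy)
  rw [eventually_nhdsWithin_iff] at h1 h2
  obtain ⟨R, hR, hsub⟩ := Metric.eventually_nhds_iff_ball.1 (h1.and h2)
  refine ⟨R, hR, fun x hx => ?_⟩
  obtain ⟨h3, h4⟩ := hsub x hx.1
  exact ⟨h3 hx.2, h4 ⟨hx.2, h3 hx.2⟩⟩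

theorem isOpen_activeSet
    (hH : ContinuousOn H (closure (Ω₂ : Set (EuclideanSpace ℝ (Fin d)))))
    (hT : ContinuousOn T {y ∈ closure (Ω₂ : Set (EuclideanSpace ℝ (Fin d))) | H y ≠ 0}) :
    IsOpen (activeSet Ω₁ Ω₂ H T) := by
  rw [isOpen_iff_mem_nhds]
  rintro y ⟨hy, hHy, hTy⟩
  obtain ⟨R, hR, hsub⟩ := exists_ball_inter_subset hH hT (subset_closure hy) hHy hTy
  filter_upwards [Metric.ball_mem_nhds y hR, Ω₂.isOpen.mem_nhds hy] with x hx hxΩ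
  exact ⟨hxΩ, hsub x ⟨hx, subset_closure hxΩ⟩⟩

/-- On each connected component of the active set, the operator is a constant multiple of the
composition with a rigid motion, which maps that component onto `Ω₁`. -/
theorem exists_rigidMotion_image_component [Nontrivial (EuclideanSpace ℝ (Fin d))]
    (hconn₁ : IsConnected (Ω₁ : Set (EuclideanSpace ℝ (Fin d))))
    (hlip₂ : IsLipschitzDomain Ω₂)
    (hbdd₂ : Bornology.IsBounded (Ω₂ : Set (EuclideanSpace ℝ (Fin d))))
    (hH : ContinuousOn H (closure (Ω₂ : Set (EuclideanSpace ℝ (Fin d)))))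
    (hT : ContinuousOn T {y ∈ closure (Ω₂ : Set (EuclideanSpace ℝ (Fin d))) | H y ≠ 0})
    (hdistr : ∀ (f : 𝓓(Ω₁, ℂ)) (φ : 𝓓(Ω₂, ℂ)),
      ∫ x in (Ω₂ : Set (EuclideanSpace ℝ (Fin d))),
          H x * f (T x) * Laplacian.laplacian (φ : EuclideanSpace ℝ (Fin d) → ℂ) x =
        ∫ x in (Ω₂ : Set (EuclideanSpace ℝ (Fin d))),
          H x * Laplacian.laplacian (f : EuclideanSpace ℝ (Fin d) → ℂ) (T x) * φ x)
    (hrobin : ∀ f : 𝓓(Ω₁, ℂ), HasNormalDeriv Ω₂ (fun y => H y * f (T y))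
      fun y => -(β y * (H y * f (T y))))
    {y₀ : EuclideanSpace ℝ (Fin d)} (hy₀ : y₀ ∈ activeSet Ω₁ Ω₂ H T) :
    ∃ D ⊆ activeSet Ω₁ Ω₂ H T, IsOpen D ∧ D.Nonempty ∧
      ∃ (L : EuclideanSpace ℝ (Fin d) ≃ₗᵢ[ℝ] EuclideanSpace ℝ (Fin d))
        (b : EuclideanSpace ℝ (Fin d)) (c : ℂ), c ≠ 0 ∧ (∀ y ∈ D, H y = c ∧ T y = L y + b) ∧
        (fun y => L y + b) '' D = Ω₁ := by
  set W := activeSet Ω₁ Ω₂ H T with hW_def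
  have hW : IsOpen W := isOpen_activeSet hH hT
  have hWΩ : W ⊆ Ω₂ := fun y hy => hy.1
  have hWcl : W ⊆ closure (Ω₂ : Set (EuclideanSpace ℝ (Fin d))) := hWΩ.trans subset_closure
  obtain ⟨hHs, hTs, hiso, hsec, hHconst⟩ := fderiv_eq_zero_of_intertwining hW hWΩ (hH.mono hWcl)
    (hT.mono fun y hy => ⟨hWcl hy, hy.2.1⟩) (fun y hy => hy.2.1) (fun y hy => hy.2.2) hdistr
  set D := connectedComponentIn W y₀ with hD_def
  have hDW : D ⊆ W := connectedComponentIn_subset W y₀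
  have hD : IsOpen D := hW.connectedComponentIn
  have hDc : IsPreconnected D := isPreconnected_connectedComponentIn
  have hy₀D : y₀ ∈ D := mem_connectedComponentIn hy₀
  obtain ⟨L, b, hL⟩ := exists_linearIsometryEquiv_eqOn hD hDc ⟨y₀, hy₀D⟩ (hTs.mono hDW)
    (fun y hy => hiso y (hDW hy)) (fun y hy => hsec y (hDW hy))
  have hHD : ∀ y ∈ D, H y = H y₀ := fun y hy =>
    hD.is_const_of_fderiv_eq_zero hDc ((hHs.mono hDW).differentiableOn (by simp))
      (fun x hx => hHconst x (hDW hx)) hy hy₀D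
  have hc : H y₀ ≠ 0 := hy₀.2.1
  have hDcl : closure D ⊆ closure (Ω₂ : Set (EuclideanSpace ℝ (Fin d))) :=
    closure_mono (hDW.trans hWΩ)
  have hHcl : ∀ y ∈ closure D, H y = H y₀ := fun y hy => by
    have : EqOn H (fun _ => H y₀) (closure D) :=
      EqOn.of_subset_closure hHD (hH.mono hDcl) continuousOn_const subset_closure le_rfl
    exact this hy
  have hTcl : ∀ y ∈ closure D, T y = L y + b := fun y hy => by
    have : EqOn T (fun y => L y + b) (closure D) :=
      EqOn.of_subset_closure hL (hT.mono fun x hx => ⟨hDcl hx, by rwa [hHcl x hx]⟩)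
        (by fun_prop) subset_closure le_rfl
    exact this hy
  have hmax : ∀ C ⊆ W, IsPreconnected C → ∀ x ∈ C, x ∈ D → C ⊆ D := fun C hCW hC x hx hxD => by
    have := hC.subset_connectedComponentIn hx hCW
    rwa [hD_def, connectedComponentIn_eq hxD]
  -- This says that the image of `D` is relatively closed in `Ω₁`. A limit point inside `Ω₂` can be
  -- adjoined to the component `D`; one on `∂Ω₂` is excluded by the Robin condition.
  have hbdry : ∀ y ∈ closure D, L y + b ∈ Ω₁ → y ∈ D := by
    intro y hy hyΩ
    have hHy : H y ≠ 0 := by rwa [hHcl y hy]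
    have hTy : T y ∈ Ω₁ := by rwa [hTcl y hy]
    by_cases hyΩ₂ : y ∈ Ω₂
    · have hyW : y ∈ W := ⟨hyΩ₂, hHy, hTy⟩
      have h1 : IsPreconnected (insert y D) :=
        hDc.subset_closure (subset_insert y D) (insert_subset hy subset_closure)
      exact hmax _ (insert_subset hyW hDW) h1 y₀ (mem_insert_of_mem _ hy₀D) hy₀D
        (mem_insert y D)
    · exfalso
      have hfr : y ∈ frontier (Ω₂ : Set (EuclideanSpace ℝ (Fin d))) := by
        refine ⟨hDcl hy, ?_⟩
        rwa [Ω₂.isOpen.interior_eq]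
      obtain ⟨R, hR, hsub⟩ := exists_ball_inter_subset hH hT (hDcl hy) hHy hTy
      have hRW : (Ω₂ : Set (EuclideanSpace ℝ (Fin d))) ∩ Metric.ball y R ⊆ W := fun x hx =>
        ⟨hx.1, hsub x ⟨hx.2, subset_closure hx.1⟩⟩
      obtain ⟨ρ, hρ, hjoin⟩ := hlip₂.exists_isPreconnected hfr hR
      obtain ⟨x₀, hx₀, hx₀D⟩ := mem_closure_iff.1 hy _ Metric.isOpen_ball (Metric.mem_ball_self hρ)
      -- All of `Ω₂` near `y` is active and joined within the active set to a point of `D`, so no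
      -- other component comes near `y`.
      have hball : (Ω₂ : Set (EuclideanSpace ℝ (Fin d))) ∩ Metric.ball y ρ ⊆ D := by
        intro x hx
        obtain ⟨C, hCsub, hC, hxC, hx₀C⟩ := hjoin x hx x₀ ⟨hWΩ (hDW hx₀D), hx₀⟩
        exact hmax C (hCsub.trans hRW) hC x₀ hx₀C hx₀D hxC
      refine rigidMotion_notMem_of_mem_frontier hlip₂ hbdd₂ hrobin hfr hc hρ (fun x hx => ?_) hyΩ
      have hxcl : x ∈ closure D := by
        have := Metric.isOpen_ball.inter_closure hx
        rw [inter_comm] at this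
        exact closure_mono hball this
      exact ⟨hHcl x hxcl, hTcl x hxcl⟩
  refine ⟨D, hDW, hD, ⟨y₀, hy₀D⟩, L, b, H y₀, hc, fun y hy => ⟨hHD y hy, hL y hy⟩, ?_⟩
  let τ : EuclideanSpace ℝ (Fin d) ≃ₜ EuclideanSpace ℝ (Fin d) :=
    L.toHomeomorph.trans (Homeomorph.addRight b)
  have hτ : ∀ y, τ y = L y + b := fun y => rfl
  have himg : τ '' D ⊆ Ω₁ := by
    rintro _ ⟨y, hy, rfl⟩
    rw [hτ, ← hL y hy]
    exact (hDW hy).2.2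
  have hopen : IsOpen (τ '' D) := τ.isOpenMap D hD
  refine Subset.antisymm himg ?_
  refine hconn₁.isPreconnected.subset_of_closure_inter_subset hopen
    ⟨τ y₀, himg ⟨y₀, hy₀D, rfl⟩, y₀, hy₀D, rfl⟩ ?_
  rintro x ⟨hx, hxΩ⟩
  change x ∈ closure (τ '' D) at hx
  rw [← τ.image_closure] at hx
  obtain ⟨y, hy, rfl⟩ := hx
  exact ⟨y, hbdry y hy hxΩ, rfl⟩

end RigidComponents

/-! ### Consequences of equal volume and of dense range. -/

section Density

variable {d : ℕ} {Ω₁ Ω₂ : Opens (EuclideanSpace ℝ (Fin d))}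

/-- Rigid motions preserve volume, so `D` has full measure in `Ω₂`; the open set `Ω₂ \ closure D` is
null, hence empty. -/
theorem subset_closure_of_volume_eq
    (hbdd₂ : Bornology.IsBounded (Ω₂ : Set (EuclideanSpace ℝ (Fin d))))
    {D : Set (EuclideanSpace ℝ (Fin d))} (hD : IsOpen D) (hDΩ : D ⊆ Ω₂)
    {L : EuclideanSpace ℝ (Fin d) ≃ₗᵢ[ℝ] EuclideanSpace ℝ (Fin d)} {b : EuclideanSpace ℝ (Fin d)}
    (himg : (fun y => L y + b) '' D = Ω₁)
    (hvol : volume (Ω₁ : Set (EuclideanSpace ℝ (Fin d))) =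
      volume (Ω₂ : Set (EuclideanSpace ℝ (Fin d)))) :
    (Ω₂ : Set (EuclideanSpace ℝ (Fin d))) ⊆ closure D := by
  have hinj : Function.Injective fun y => L y + b := fun x y hxy =>
    L.injective (add_right_cancel hxy)
  have hvD : volume D = volume (Ω₁ : Set (EuclideanSpace ℝ (Fin d))) := by
    have h1 : D = L ⁻¹' ((fun x => x + b) ⁻¹' (Ω₁ : Set (EuclideanSpace ℝ (Fin d)))) := by
      rw [← himg]
      exact (preimage_image_eq D hinj).symm
    rw [h1, L.measurePreserving.measure_preimage
      (Ω₁.isOpen.preimage (by fun_prop)).measurableSet.nullMeasurableSet,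
      measure_preimage_add_right]
  have hnull : volume ((Ω₂ : Set (EuclideanSpace ℝ (Fin d))) \ closure D) = 0 := by
    refine measure_mono_null (sdiff_subset_sdiff_right subset_closure) ?_
    have hfin : volume D ≠ ⊤ := ((measure_mono hDΩ).trans_lt hbdd₂.measure_lt_top).ne
    rw [measure_sdiff hDΩ hD.measurableSet.nullMeasurableSet hfin, hvD, hvol, tsub_self]
  rw [(Ω₂.isOpen.sdiff isClosed_closure).measure_eq_zero_iff volume] at hnull
  exact sdiff_eq_empty.1 hnull

variable {U : C(closure (Ω₁ : Set (EuclideanSpace ℝ (Fin d))), ℂ) →L[ℂ]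
      C(closure (Ω₂ : Set (EuclideanSpace ℝ (Fin d))), ℂ)}

/-- At a zero of the weight every function in the range vanishes, hence every function in its
closure, including `1`. -/
theorem weight_ne_zero_of_denseRange
    (hbdd₁ : Bornology.IsBounded (Ω₁ : Set (EuclideanSpace ℝ (Fin d))))
    (hne₁ : (Ω₁ : Set (EuclideanSpace ℝ (Fin d))).Nonempty)
    (ha : ∀ f g : C(closure (Ω₁ : Set (EuclideanSpace ℝ (Fin d))), ℂ), f * g = 0 → U f * U g = 0)
    (hU : DenseRange U) {y : EuclideanSpace ℝ (Fin d)}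
    (hy : y ∈ closure (Ω₂ : Set (EuclideanSpace ℝ (Fin d)))) : weight U y ≠ 0 := by
  intro h0
  have hcl : IsClosed {u : C(closure (Ω₂ : Set (EuclideanSpace ℝ (Fin d))), ℂ) |
      u ⟨y, hy⟩ = 0} := isClosed_eq (by fun_prop) continuous_const
  have h1 : ∀ u, u ∈ {u : C(closure (Ω₂ : Set (EuclideanSpace ℝ (Fin d))), ℂ) |
      u ⟨y, hy⟩ = 0} := fun u => hU.induction_on u hcl fun f => by
    obtain ⟨x, hx⟩ := exists_apply_eq_weight_mul hbdd₁ hne₁ ha ⟨y, hy⟩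
    rw [mem_ofPred_eq, hx f, h0, zero_mul]
  exact one_ne_zero (h1 1)

theorem injOn_symbol_of_denseRange
    (hbdd₁ : Bornology.IsBounded (Ω₁ : Set (EuclideanSpace ℝ (Fin d))))
    (hne₁ : (Ω₁ : Set (EuclideanSpace ℝ (Fin d))).Nonempty)
    (ha : ∀ f g : C(closure (Ω₁ : Set (EuclideanSpace ℝ (Fin d))), ℂ), f * g = 0 → U f * U g = 0)
    (hU : DenseRange U) :
    InjOn (symbol U) (closure (Ω₂ : Set (EuclideanSpace ℝ (Fin d)))) := by
  intro y hy z hz hyz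
  by_contra hne
  have hwy := weight_ne_zero_of_denseRange hbdd₁ hne₁ ha hU hy
  have hwz := weight_ne_zero_of_denseRange hbdd₁ hne₁ ha hU hz
  -- If `symbol` agrees at `y` and `z`, functions in the range take values at the two points in the
  -- fixed ratio of the weights. This linear relation passes to the closure but fails for the
  -- distance to `z`.
  have hcl : IsClosed {u : C(closure (Ω₂ : Set (EuclideanSpace ℝ (Fin d))), ℂ) |
      u ⟨y, hy⟩ * weight U z = u ⟨z, hz⟩ * weight U y} :=
    isClosed_eq (by fun_prop) (by fun_prop)
  have h1 : ∀ u, u ∈ {u : C(closure (Ω₂ : Set (EuclideanSpace ℝ (Fin d))), ℂ) |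
      u ⟨y, hy⟩ * weight U z = u ⟨z, hz⟩ * weight U y} := fun u => hU.induction_on u hcl fun f => by
    obtain ⟨hTy, hfy⟩ := exists_apply_eq_symbol hbdd₁ hne₁ ha ⟨y, hy⟩ hwy
    obtain ⟨hTz, hfz⟩ := exists_apply_eq_symbol hbdd₁ hne₁ ha ⟨z, hz⟩ hwz
    rw [mem_ofPred_eq, hfy, hfz]
    simp only [hyz]
    ring
  have h2 := h1 ⟨fun x => ((dist (x : EuclideanSpace ℝ (Fin d)) z : ℝ) : ℂ), by fun_prop⟩
  simp only [mem_ofPred_eq, ContinuousMap.coe_mk, dist_self, Complex.ofReal_zero, zero_mul,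
    mul_eq_zero, Complex.ofReal_eq_zero, dist_eq_zero] at h2
  exact h2.elim hne hwz

end Density

end RobinCongruence

end

/-! ### The main theorem. -/

theorem mainTheorem8 (d : ℕ) (hd : 1 ≤ d)
    (Ω₁ Ω₂ : TopologicalSpace.Opens (EuclideanSpace ℝ (Fin d)))
    (hconn₁ : IsConnected (Ω₁ : Set (EuclideanSpace ℝ (Fin d))))
    (hconn₂ : IsConnected (Ω₂ : Set (EuclideanSpace ℝ (Fin d))))
    (hbdd₁ : Bornology.IsBounded (Ω₁ : Set (EuclideanSpace ℝ (Fin d))))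
    (hbdd₂ : Bornology.IsBounded (Ω₂ : Set (EuclideanSpace ℝ (Fin d))))
    -- for `d = 1` the hypotheses above say that both domains are bounded open intervals
    (hlip₁ : 2 ≤ d → RobinCongruence.IsLipschitzDomain Ω₁)
    (hlip₂ : 2 ≤ d → RobinCongruence.IsLipschitzDomain Ω₂)
    (U : C(closure (Ω₁ : Set (EuclideanSpace ℝ (Fin d))), ℂ) →L[ℂ]
      C(closure (Ω₂ : Set (EuclideanSpace ℝ (Fin d))), ℂ))
    (ha : ∀ f g : C(closure (Ω₁ : Set (EuclideanSpace ℝ (Fin d))), ℂ),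
      f * g = 0 → U f * U g = 0)
    (hb : ∃ β : C(frontier (Ω₂ : Set (EuclideanSpace ℝ (Fin d))), ℂ),
      ∀ f : 𝓓(Ω₁, ℂ), U (RobinCongruence.testRestrict f) ∈ RobinCongruence.robinDomain Ω₂ β)
    (hb' : ∀ f : 𝓓(Ω₁, ℂ), RobinCongruence.IsWeakLaplacian Ω₂
      (RobinCongruence.zeroExt (U (RobinCongruence.testRestrict f)))
      (RobinCongruence.zeroExt (U (RobinCongruence.testLaplacian f))))
    (hc : ∀ V : Set (EuclideanSpace ℝ (Fin d)), IsOpen V → V ⊆ Ω₂ →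
      (∀ f : 𝓓(Ω₁, ℂ), ∀ y : closure (Ω₂ : Set (EuclideanSpace ℝ (Fin d))),
        (y : EuclideanSpace ℝ (Fin d)) ∈ V → U (RobinCongruence.testRestrict f) y = 0) →
      V = ∅)
    (hde : volume (Ω₁ : Set (EuclideanSpace ℝ (Fin d))) =
        volume (Ω₂ : Set (EuclideanSpace ℝ (Fin d))) ∨ DenseRange U) :
    ∃ (τ : EuclideanSpace ℝ (Fin d) ≃ᵢ EuclideanSpace ℝ (Fin d)) (c : ℂ),
      τ '' (Ω₂ : Set (EuclideanSpace ℝ (Fin d))) = Ω₁ ∧ c ≠ 0 ∧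
      ∀ (f : C(closure (Ω₁ : Set (EuclideanSpace ℝ (Fin d))), ℂ))
        (y : closure (Ω₂ : Set (EuclideanSpace ℝ (Fin d)))),
        ∃ hy : τ y ∈ closure (Ω₁ : Set (EuclideanSpace ℝ (Fin d))),
          U f y = c * f ⟨τ y, hy⟩ := by

  have : NeZero d := ⟨by omega⟩
  have hl₁ : RobinCongruence.IsLipschitzDomain Ω₁ := by
    rcases hd.eq_or_lt with rfl | h
    · exact RobinCongruence.isLipschitzDomain_of_isConnected hconn₁
    · exact hlip₁ h
  have hl₂ : RobinCongruence.IsLipschitzDomain Ω₂ := by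
    rcases hd.eq_or_lt with rfl | h
    · exact RobinCongruence.isLipschitzDomain_of_isConnected hconn₂
    · exact hlip₂ h
  set H := RobinCongruence.weight U
  set T := RobinCongruence.symbol U
  have hH : ContinuousOn H (closure (Ω₂ : Set (EuclideanSpace ℝ (Fin d)))) :=
    RobinCongruence.continuousOn_weight
  have hT : ContinuousOn T {y ∈ closure (Ω₂ : Set (EuclideanSpace ℝ (Fin d))) | H y ≠ 0} :=
    RobinCongruence.continuousOn_symbol
  have htest : ∀ f : 𝓓(Ω₁, ℂ), RobinCongruence.zeroExt (U (RobinCongruence.testRestrict f)) =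
      fun y => H y * f (T y) := fun f =>
    RobinCongruence.zeroExt_apply_eq hbdd₁ hconn₁.nonempty ha _ fun x => rfl
  have hlap : ∀ f : 𝓓(Ω₁, ℂ), RobinCongruence.zeroExt (U (RobinCongruence.testLaplacian f)) =
      fun y => H y * Laplacian.laplacian (f : EuclideanSpace ℝ (Fin d) → ℂ) (T y) := fun f =>
    RobinCongruence.zeroExt_apply_eq hbdd₁ hconn₁.nonempty ha _ fun x => rfl
  have hdistr : ∀ (f : 𝓓(Ω₁, ℂ)) (φ : 𝓓(Ω₂, ℂ)),
      ∫ x in (Ω₂ : Set (EuclideanSpace ℝ (Fin d))),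
          H x * f (T x) * Laplacian.laplacian (φ : EuclideanSpace ℝ (Fin d) → ℂ) x =
        ∫ x in (Ω₂ : Set (EuclideanSpace ℝ (Fin d))),
          H x * Laplacian.laplacian (f : EuclideanSpace ℝ (Fin d) → ℂ) (T x) * φ x := by
    intro f φ
    have := hb' f φ
    rwa [htest, hlap] at this
  obtain ⟨β, hβ⟩ := hb
  have hrobin : ∀ f : 𝓓(Ω₁, ℂ), RobinCongruence.HasNormalDeriv Ω₂ (fun y => H y * f (T y))
      fun y => -(RobinCongruence.zeroExt β y * (H y * f (T y))) := by
    intro f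
    have := (hβ f).2
    rwa [htest] at this
  -- At an inactive point of `Ω₂` either the weight vanishes or `T` leaves `Ω₁`, where test
  -- functions vanish; so (c) applies to the open set `Ω₂ \ closure W`.
  have hdense : (Ω₂ : Set (EuclideanSpace ℝ (Fin d))) ⊆
      closure (RobinCongruence.activeSet Ω₁ Ω₂ H T) := by
    rw [← sdiff_eq_empty]
    refine hc _ (Ω₂.isOpen.sdiff isClosed_closure) sdiff_subset fun f y hy => ?_
    have h1 : U (RobinCongruence.testRestrict f) y = H y * f (T y) := by
      rw [← RobinCongruence.zeroExt_apply _ y.2, htest]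
    rw [h1, mul_eq_zero, or_iff_not_imp_left]
    intro hHy
    refine image_eq_zero_of_notMem_tsupport fun h => hy.2 (subset_closure ⟨hy.1, hHy, ?_⟩)
    exact f.tsupport_subset h
  obtain ⟨y₀, hy₀⟩ : (RobinCongruence.activeSet Ω₁ Ω₂ H T).Nonempty :=
    closure_nonempty_iff.1 (hconn₂.nonempty.mono hdense)
  obtain ⟨D, hDW, hD, -, L, b, c, hc0, hHT, himg⟩ :=
    RobinCongruence.exists_rigidMotion_image_component hconn₁ hl₂ hbdd₂ hH hT hdistr hrobin hy₀
  have hDΩ : D ⊆ Ω₂ := fun y hy => (hDW hy).1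
  have hΩD : (Ω₂ : Set (EuclideanSpace ℝ (Fin d))) ⊆ closure D := by
    rcases hde with hvol | hU
    · exact RobinCongruence.subset_closure_of_volume_eq hbdd₂ hD hDΩ himg hvol
    -- Any active point has its image in `Ω₁ = T(D)`, so injectivity of `T` puts it in `D`.
    · refine hdense.trans (closure_mono fun y hy => ?_)
      have hTy : T y ∈ (fun y => L y + b) '' D := himg.symm ▸ hy.2.2
      obtain ⟨x, hx, hxy⟩ := hTy
      have hxy' : T x = T y := (hHT x hx).2.trans hxy
      rwa [← RobinCongruence.injOn_symbol_of_denseRange hbdd₁ hconn₁.nonempty ha hU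
        (subset_closure (hDΩ hx)) (subset_closure hy.1) hxy']
  have hcl : closure (Ω₂ : Set (EuclideanSpace ℝ (Fin d))) = closure D :=
    Subset.antisymm (closure_minimal hΩD isClosed_closure) (closure_mono hDΩ)
  let τ : EuclideanSpace ℝ (Fin d) ≃ᵢ EuclideanSpace ℝ (Fin d) :=
    L.toIsometryEquiv.trans (IsometryEquiv.addRight b)
  have hτD : τ '' D = Ω₁ := himg
  have hτcl : τ '' closure (Ω₂ : Set (EuclideanSpace ℝ (Fin d))) =
      closure (Ω₁ : Set (EuclideanSpace ℝ (Fin d))) := by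
    rw [hcl, ← hτD]
    exact τ.toHomeomorph.image_closure D
  have hτmem : ∀ y ∈ closure (Ω₂ : Set (EuclideanSpace ℝ (Fin d))),
      τ y ∈ closure (Ω₁ : Set (EuclideanSpace ℝ (Fin d))) := fun y hy =>
    hτcl ▸ mem_image_of_mem τ hy
  refine ⟨τ, c, Subset.antisymm ?_ (hτD ▸ image_mono hDΩ), hc0, fun f y => ⟨hτmem y y.2, ?_⟩⟩
  -- The open set `τ(Ω₂)` lies in `closure Ω₁`, hence in its interior, which is contained in `Ω₁`.
  · refine subset_trans (interior_maximal ?_ (τ.toHomeomorph.isOpenMap _ Ω₂.isOpen))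
      hl₁.interior_closure_subset
    exact (image_mono subset_closure).trans hτcl.subset
  · have h1 : ContinuousOn (RobinCongruence.zeroExt (U f))
        (closure (Ω₂ : Set (EuclideanSpace ℝ (Fin d)))) := RobinCongruence.continuousOn_zeroExt _
    have h2 : ContinuousOn (fun y => c * RobinCongruence.zeroExt f (τ y))
        (closure (Ω₂ : Set (EuclideanSpace ℝ (Fin d)))) :=
      continuousOn_const.mul
        ((RobinCongruence.continuousOn_zeroExt f).comp τ.continuous.continuousOn hτmem)
    have h3 : EqOn (RobinCongruence.zeroExt (U f)) (fun y => c * RobinCongruence.zeroExt f (τ y))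
        D := by
      intro x hx
      have hxcl := subset_closure (hDΩ hx)
      have hHx : H x ≠ 0 := by rwa [(hHT x hx).1]
      obtain ⟨hTx, hf⟩ :=
        RobinCongruence.exists_apply_eq_symbol hbdd₁ hconn₁.nonempty ha ⟨x, hxcl⟩ hHx
      have hTτ : T x = τ x := (hHT x hx).2
      simp only
      rw [RobinCongruence.zeroExt_apply _ hxcl, hf f, RobinCongruence.zeroExt_apply f (hτmem x hxcl)]
      congr 1
      · exact (hHT x hx).1
      · congr 1
        exact Subtype.ext hTτ
    have h4 := EqOn.of_subset_closure h3 h1 h2 (hDΩ.trans subset_closure) hcl.subset y.2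
    change RobinCongruence.zeroExt (U f) y = c * RobinCongruence.zeroExt f (τ y) at h4
    rwa [RobinCongruence.zeroExt_apply _ y.2, RobinCongruence.zeroExt_apply f (hτmem y y.2)] at h4
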